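/- **Setting.** Let $\Pi$ be a finite non-empty set of decisions, $O$ a measurable space with a $\sigma$-finite base measure $\nu$, and $R:O\to\mathbb R$ a measurable reward function. An instance $f$ assigns to each $\pi\in\Pi$ a bounded probability density $f[\pi]$ with respect to $\nu$ (we also write $f[\pi]$ for the distribution). Let $\mathcal F$ be a finite set of instances such that $0\le R(o)\le R_{\max}$ for $f[\pi]$-almost every $o$, for all $f\in\mathcal F$, $\pi\in\Pi$. Put $R_f(\pi)=\mathbb E_{o\sim f[\pi]}[R(o)]$ and assume that each $f\in\mathcal F$ has a unique optimal decision $\pi^\star(f)=\arg\max_\pi R_f(\pi)$; let $\Delta(f,\pi)=R_f(\pi^\star(f))-R_f(\pi)$. In round $t$ the learner chooses $\pi_t$ from the history and observes $o_t\sim f^\star[\pi_t]$, where $f^\star\in\mathcal F$ is unknown, and $$\mathrm{Reg}_{f^\star,n}=\mathbb E_{f^\star}\Big[\sum_{t=1}^n\big(\max_{\pi}R_{f^\star}(\pi)-R_{f^\star}(\pi_t)\big)\Big].$$ **Complexity.** For $f\in\mathcal F$ and $N\in\mathbb R$ let $\mathcal C(f,N)$ be the infimum of $\sum_\pi w_\pi\Delta(f,\pi)$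 over $w\in\mathbb R_{\ge0}^{\Pi}$ with $w_\pi\le N$ for all $\pi$ and $\sum_\pi w_\pi D_{\mathrm{KL}}(f[\pi]\|g[\pi])\ge1$ for all $g\in\mathcal F$ with $\pi^\star(g)\ne\pi^\star(f)$ (with $0\cdot\infty=0$ and $\inf\emptyset=\infty$), and let $\mathcal C(f)=\lim_{N\to\infty}\mathcal C(f,N)$. **Condition 1.** For $\zeta\in(0,1)$ let $D_\zeta(p\|q)=\frac1{\zeta-1}\ln\int p^\zeta q^{1-\zeta}\,d\nu\in[0,\infty]$. There are constants $c_1,c_2,c_3>0$, numbers $\iota(f)>0$ $(f\in\mathcal F)$ and numbers $\lambda_0(\alpha,\epsilon,f)\ge\epsilon^{c_1}\min\{1/\alpha,c_2\}^{c_3}\iota(f)$ such that for all $\alpha>0$, $\epsilon\in(0,1)$, $f,g\in\mathcal F$, $\pi\in\Pi$ and all $\lambda\in(0,1)$ with $\lambda\le\lambda_0(\alpha,\epsilon,f)$, $$D_{1-\lambda}(f[\pi]\|g[\pi])\ge\min\{D_{\mathrm{KL}}(f[\pi]\|g[\pi])-\epsilon,\ \alpha\}.$$ **Algorithm Test-to-Commit**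 (horizon $n$, $N_n=(\ln\ln n)^{1/4}$). 1. *Initialization.* Play each decision $\lceil\ln n/\ln\ln n\rceil$ times, in any order; let $\hat f\in\mathcal F$ maximize the log-likelihood $\sum_i\ln f[\hat\pi_i](\hat o_i)$ of these rounds over $f\in\mathcal F$ ($\ln0=-\infty$), with arbitrary tie-breaking. 2. *Identification.* Let $\hat w$ be a solution of the program defining $\mathcal C(\hat f,N_n)$; more generally, any feasible point whose value is at most $\mathcal C(\hat f,N_n)+\eta_n$, where $\eta_n\ge0$ is a fixed sequence with $\eta_n\to0$ (this matters when the infimum is not attained, which can happen if some KL divergence is infinite). If the program is infeasible, $\hat w$ is arbitrary. Put $\bar w_\pi=(1+1/N_n)\hat w_\pi+1/N_n$ and play each $\pi$ exactly $\lceil\bar w_\pi\ln n\rceil$ times, in any order depending only on $\hat f$; let $(\pi_i,o_i)_{i\le m}$ be these rounds. Accept $\hat f$ if $\sum_{i=1}^m\ln\frac{\hat f[\pi_i](o_i)}{g[\pi_i](o_i)}\ge\ln n$ for all $g\in\mathcal F$ with $\pi^\star(g)\ne\pi^\star(\hat f)$ (with $x/0=\infty$ for $x>0$, $0/0=0$,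 and a sum with a term $-\infty$ equal to $-\infty$). 3. *Exploitation.* If $\hat f$ is accepted, play $\pi^\star(\hat f)$ in all remaining rounds. Otherwise run UCB afresh in the remaining rounds: always play a decision with the largest index, arbitrary tie-breaking, where the index is $\infty$ for a decision not yet played in this step and otherwise its average reward in this step plus $R_{\max}\sqrt{2\ln(n^2)/T}$, with $T$ the number of its plays in this step. Only the first $n$ rounds count; for the finitely many small $n$ for which the formulas above are undefined, the algorithm is arbitrary. **Theorem.** If $\mathcal F$ is finite and satisfies Condition 1, then for every $f^\star\in\mathcal F$ the limit $\mathcal C(f^\star)$ exists and is finite, and Test-to-Commit satisfies $$\limsup_{n\to\infty}\frac{\mathrm{Reg}_{f^\star,n}}{\ln n}\le\mathcal C(f^\star).$$ -/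

import Mathlib

open MeasureTheory ProbabilityTheory Filter Topology
open scoped ENNReal NNReal

noncomputable section

namespace DecisionMaking

variable {D O : Type*} [MeasurableSpace O]

/-- An instance `f` of an interactive decision making problem with decisions `D` and observations
`O`: for every decision `π`, a bounded probability density `f[π]` with respect to the base measure
`ν`. -/
structure Instance (D : Type*) {O : Type*} [MeasurableSpace O] (ν : Measure O) where
  /-- `density π o` is `f[π](o)`. -/
  density : D → O → ℝ≥0∞
  measurable_density : ∀ π, Measurable (density π)
  lintegral_density : ∀ π, ∫⁻ o, density π o ∂ν = 1
  bounded_density : ∀ π, ⨆ o, density π o < ∞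

variable {ν : Measure O}

/-- The distribution `f[π]` of the observation when decision `π` is played under `f`. -/
def Instance.law (f : Instance D ν) (π : D) : Measure O := ν.withDensity (f.density π)

/-- Expected reward `R_f(π) = E_{o ∼ f[π]} [R(o)]`. -/
def meanReward (R : O → ℝ) (f : Instance D ν) (π : D) : ℝ := ∫ o, R o ∂(f.law π)

/-- `π` maximizes the expected reward under `f`. -/
def IsOptimal (R : O → ℝ) (f : Instance D ν) (π : D) : Prop :=
  ∀ π', meanReward R f π' ≤ meanReward R f π

/-- The optimal decision `π⋆(f)`. -/
def optDecision [Finite D] [Nonempty D] (R : O → ℝ) (f : Instance D ν) : D :=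
  (Finite.exists_max (meanReward R f)).choose

/-- The sub-optimality gap `Δ(f, π) = R_f(π⋆(f)) - R_f(π)`. -/
def gap [Finite D] [Nonempty D] (R : O → ℝ) (f : Instance D ν) (π : D) : ℝ :=
  meanReward R f (optDecision R f) - meanReward R f π

/-! ### Divergences and the uniform convergence condition -/

/-- The Kullback-Leibler divergence `D_KL(f[π] ‖ g[π])`. -/
def kl (f g : Instance D ν) (π : D) : ℝ≥0∞ := InformationTheory.klDiv (f.law π) (g.law π)

/-- The Rényi divergence `D_ζ(f[π] ‖ g[π]) = (ζ - 1)⁻¹ ln ∫ f[π]^ζ g[π]^(1 - ζ) dν` for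
`0 < ζ < 1`; it is `⊤` if the integral vanishes. -/
def renyi (ζ : ℝ) (f g : Instance D ν) (π : D) : EReal :=
  (((ζ - 1)⁻¹ : ℝ) : EReal) *
    ENNReal.log (∫⁻ o, f.density π o ^ ζ * g.density π o ^ (1 - ζ) ∂ν)

/-- Uniform convergence of the Rényi divergences `D_{1-λ}` to the KL divergence on the class `F`. -/
def UniformRenyiConvergence (F : Finset (Instance D ν)) : Prop :=
  ∃ (c₁ c₂ c₃ : ℝ) (ι : Instance D ν → ℝ) (lam₀ : ℝ → ℝ → Instance D ν → ℝ),
    0 < c₁ ∧ 0 < c₂ ∧ 0 < c₃ ∧ (∀ f ∈ F, 0 < ι f) ∧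
    ∀ α : ℝ, 0 < α → ∀ ε : ℝ, 0 < ε → ε < 1 → ∀ f ∈ F,
      ε ^ c₁ * min (1 / α) c₂ ^ c₃ * ι f ≤ lam₀ α ε f ∧
      ∀ lam : ℝ, 0 < lam → lam < 1 → lam ≤ lam₀ α ε f → ∀ g ∈ F, ∀ π : D,
        min ((kl f g π : EReal) - (ε : EReal)) (α : EReal) ≤ renyi (1 - lam) f g π

/-! ### The complexity measure -/

section Complexity

variable [Fintype D] [Nonempty D]

/-- The objective `∑_π w_π Δ(f, π)`. -/
def cost (R : O → ℝ) (f : Instance D ν) (w : D → ℝ≥0) : ℝ := ∑ π, (w π : ℝ) * gap R f π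

/-- The constraints of the program defining `C(f, N)`. -/
def IsFeasible (R : O → ℝ) (F : Finset (Instance D ν)) (f : Instance D ν) (N : ℝ)
    (w : D → ℝ≥0) : Prop :=
  (∀ g ∈ F, optDecision R g ≠ optDecision R f → 1 ≤ ∑ π, (w π : ℝ≥0∞) * kl f g π) ∧
    ∀ π, (w π : ℝ) ≤ N

/-- The value `C(f, N)` of the program (`⊤` if it is infeasible). -/
def complexityAt (R : O → ℝ) (F : Finset (Instance D ν)) (f : Instance D ν) (N : ℝ) : EReal :=
  ⨅ (w : D → ℝ≥0) (_ : IsFeasible R F f N w), (cost R f w : EReal)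

/-- The asymptotic complexity `C(f) = lim_{N → ∞} C(f, N)`. -/
def complexity (R : O → ℝ) (F : Finset (Instance D ν)) (f : Instance D ν) : EReal :=
  limUnder atTop (fun N : ℝ => complexityAt R F f N)

/-- `w` is a solution, up to an additive error `η` in the value, of the program defining
`C(f, N)`. For `η = 0` this says that `w` is a minimizer. -/
def IsSolution (R : O → ℝ) (F : Finset (Instance D ν)) (f : Instance D ν) (N : ℝ) (η : ℝ≥0)
    (w : D → ℝ≥0) : Prop :=
  IsFeasible R F f N w ∧ ∀ w', IsFeasible R F f N w' → cost R f w ≤ cost R f w' + η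

end Complexity

/-! ### Interaction and regret -/

/-- A history of `t` rounds: the decision and the observation of each round. -/
abbrev History (D O : Type*) (t : ℕ) : Type _ := Fin t → D × O

/-- A (measurable) rule that selects the next decision from the history. -/
structure Policy (D O : Type*) [MeasurableSpace D] [MeasurableSpace O] where
  act : (t : ℕ) → History D O t → D
  measurable_act : ∀ t, Measurable (act t)

/-- The law of the first `t` rounds when policy `A` is run on instance `f`: given the history `h`,
the next decision is `A(h)` and the next observation is drawn from `f[A(h)]`. -/
def historyLaw [MeasurableSpace D] (f : Instance D ν) (A : Policy D O) :
    (t : ℕ) → Measure (History D O t)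
  | 0 => Measure.dirac Fin.elim0
  | t + 1 => (historyLaw f A t).bind fun h =>
      (f.law (A.act t h)).map fun o => Fin.snoc (α := fun _ => D × O) h (A.act t h, o)

/-- The expected regret of `A` on `f` over `n` rounds. -/
def regret [MeasurableSpace D] (R : O → ℝ) (f : Instance D ν) (A : Policy D O) (n : ℕ) : ℝ :=
  ∫ h, ∑ i : Fin n, ((⨆ π, meanReward R f π) - meanReward R f (h i).1) ∂(historyLaw f A n)

/-! ### The Test-to-Commit algorithm -/

/-- The log-likelihood `∑_i ln f[π_i](o_i)` of a history, with `ln 0 = -∞`. -/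
def logLikelihood (f : Instance D ν) {t : ℕ} (h : History D O t) : EReal :=
  ∑ i, ENNReal.log (f.density (h i).1 (h i).2)

/-- The log-likelihood ratio `∑_i ln (f[π_i](o_i) / g[π_i](o_i))` over the rounds `a ≤ i < b`
(rounds are numbered from `0`). Here `x / 0 = ∞` for `x > 0`, `0 / 0 = 0`, and a sum with a term
`-∞` is `-∞`. -/
def logLikelihoodRatio (f g : Instance D ν) {t : ℕ} (h : History D O t) (a b : ℕ) : EReal :=
  ∑ i ∈ Finset.univ.filter (fun i : Fin t => a ≤ (i : ℕ) ∧ (i : ℕ) < b),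
    ENNReal.log (f.density (h i).1 (h i).2 / g.density (h i).1 (h i).2)

/-- The test of `f` on the rounds `a ≤ i < b`: all log-likelihood ratios against instances with a
different optimal decision are at least `ln n`. -/
def Accepts [Finite D] [Nonempty D] (R : O → ℝ) (F : Finset (Instance D ν)) (n : ℕ)
    (f : Instance D ν) {t : ℕ} (h : History D O t) (a b : ℕ) : Prop :=
  ∀ g ∈ F, optDecision R g ≠ optDecision R f →
    ((Real.log n : ℝ) : EReal) ≤ logLikelihoodRatio f g h a b

section UCB

variable [DecidableEq D]

/-- The number of times that `π` is played in the rounds `i ≥ s` of `h`. -/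
def playCount {t : ℕ} (h : History D O t) (s : ℕ) (π : D) : ℕ :=
  (Finset.univ.filter fun i : Fin t => s ≤ (i : ℕ) ∧ (h i).1 = π).card

/-- The average reward of `π` in the rounds `i ≥ s` of `h`. -/
def empiricalMean (R : O → ℝ) {t : ℕ} (h : History D O t) (s : ℕ) (π : D) : ℝ :=
  (∑ i ∈ Finset.univ.filter (fun i : Fin t => s ≤ (i : ℕ) ∧ (h i).1 = π), R (h i).2) /
    playCount h s π

/-- The index of the algorithm UCB(δ) with `δ = 1 / n ^ 2`, started in round `s`, for rewards in
`[0, Rmax]`: it is `∞` for a decision that was not played yet, and otherwise the average reward plus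
`Rmax * √(2 ln (1 / δ) / T)`, where `T` is the number of plays. -/
def ucbIndex (R : O → ℝ) (Rmax : ℝ) (n : ℕ) {t : ℕ} (h : History D O t) (s : ℕ) (π : D) : EReal :=
  if playCount h s π = 0 then ⊤
  else ((empiricalMean R h s π +
    Rmax * Real.sqrt (2 * Real.log ((n : ℝ) ^ 2) / playCount h s π) : ℝ) : EReal)

end UCB

/-- The bound `(ln ln n)^{1/4}` in the program that the algorithm solves. -/
def programBound (n : ℕ) : ℝ := Real.log (Real.log n) ^ (1 / 4 : ℝ)

/-- A run of Test-to-Commit with horizon `n`: the steps of the algorithm together with the choices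
that it leaves open (the order of the plays within a step, the solution of the program, and the
tie-breaking in the maximum likelihood estimation and in UCB). -/
structure TestToCommit [Fintype D] [DecidableEq D] [Nonempty D] [MeasurableSpace D]
    (R : O → ℝ) (Rmax : ℝ) (F : Finset (Instance D ν)) (n : ℕ) (η : ℝ≥0)
    extends Policy D O where
  /-- The decisions of the initialization step. -/
  initList : List D
  count_initList : ∀ π, initList.count π = ⌈Real.log n / Real.log (Real.log n)⌉₊
  /-- The maximum likelihood estimate. -/
  mle : History D O initList.length → F
  measurable_mle : ∀ f, MeasurableSet (mle ⁻¹' {f})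
  isMax_mle : ∀ h, ∀ f ∈ F, logLikelihood f h ≤ logLikelihood (mle h : Instance D ν) h
  /-- The solution of the program defining `C(f, (ln ln n)^{1/4})`. -/
  weight : F → D → ℝ≥0
  isSolution_weight : ∀ f : F, (∃ w, IsFeasible R F f (programBound n) w) →
    IsSolution R F f (programBound n) η (weight f)
  /-- The decisions of the identification step, given the estimate. -/
  identList : F → List D
  count_identList : ∀ f π, (identList f).count π =
    ⌈((1 + 1 / programBound n) * weight f π + 1 / programBound n) * Real.log n⌉₊
  act_init : ∀ t (ht : t < initList.length) h, act t h = initList[t]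
  act_ident : ∀ t (ht : initList.length ≤ t) h f, mle (fun i => h (Fin.castLE ht i)) = f →
    ∀ hlt : t - initList.length < (identList f).length,
      act t h = (identList f)[t - initList.length]
  act_commit : ∀ t (ht : initList.length ≤ t) h f, mle (fun i => h (Fin.castLE ht i)) = f →
    initList.length + (identList f).length ≤ t →
    Accepts R F n f h initList.length (initList.length + (identList f).length) →
      act t h = optDecision R (f : Instance D ν)
  act_ucb : ∀ t (ht : initList.length ≤ t) h f, mle (fun i => h (Fin.castLE ht i)) = f →
    initList.length + (identList f).length ≤ t →
    ¬ Accepts R F n f h initList.length (initList.length + (identList f).length) →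
      ∀ π, ucbIndex R Rmax n h (initList.length + (identList f).length) π ≤
        ucbIndex R Rmax n h (initList.length + (identList f).length) (act t h)

end DecisionMaking

end

/-! The regret is split along the three steps of the algorithm. Write N = (ln ln n)^{1/4}.
Initialization lasts O(ln n / ln ln n) = o(ln n) rounds. If the estimate has the true laws,
identification costs (1 + 1/N)(C(f⋆, N) + η) ln n + o(ln n), and exploitation is free once the
estimate is accepted. Since C(f⋆, N) decreases to C(f⋆), this gives the leading term.

Everything else is the probability of a failure times its cost. A wrong estimate has probability at
most |F| exp(-c ln n / ln ln n), which beats the cost O(N ln n) of a useless identification step and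
of UCB. Accepting a wrong optimal decision has probability at most |F|/n, against a cost O(n).
Rejecting a correct estimate has probability o(1), against the cost O(ln n) of UCB. Failure of the
UCB confidence intervals has probability O(n^{-5}), against O(n).

All four probabilities come from Markov's inequality for a product of factors with conditional mean
at most 1 (`exists_event_prod_lt`). For the correct estimate f and an alternative g the factor is
(g/f)^λ, whose mean is at most exp(-λ D_{1-λ}). Condition 1 replaces D_{1-λ} by the KL divergence
less ε = 1/(4|D|N²), capped at α = 2N. The inflated weights exceed the required information by a
margin 1/(2N) (`one_add_le_sum_mul_truncKL`), so rejection has probability at most |F|² exp(-λ ln n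
/ (2N)). Here λ is a negative power of N, up to a constant, and N is a power of ln ln n, so the
exponent diverges.

Likelihoods cannot separate instances with equal laws, so correctness of the estimate means equality
of laws; gaps, divergences and the program depend on nothing else. -/

namespace DecisionMaking

/-! ### The law of the interaction and Markov's inequality for adaptive products -/

section HistoryLaw

variable {D O : Type*} [MeasurableSpace O] {ν : Measure O}

instance Instance.isProbabilityMeasure_law (f : Instance D ν) (π : D) :
    IsProbabilityMeasure (f.law π) :=
  ⟨by rw [Instance.law, withDensity_apply _ MeasurableSet.univ, Measure.restrict_univ,
    f.lintegral_density]⟩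

theorem Instance.density_ne_top (f : Instance D ν) (π : D) (o : O) : f.density π o ≠ ∞ :=
  ((le_iSup (f.density π) o).trans_lt (f.bounded_density π)).ne

variable [Fintype D] [MeasurableSpace D] [DiscreteMeasurableSpace D]

theorem measurable_snoc {α : Type*} [MeasurableSpace α] (t : ℕ) :
    Measurable fun p : (Fin t → α) × α => (Fin.snoc (α := fun _ => α) p.1 p.2 : Fin (t + 1) → α) := by
  refine measurable_pi_iff.2 fun i => ?_
  refine Fin.lastCases ?_ (fun j => ?_) i
  · simpa using measurable_snd
  · simp only [Fin.snoc_castSucc]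
    exact (measurable_pi_apply j).comp measurable_fst

theorem measurable_historyStep (f : Instance D ν) (A : Policy D O) (t : ℕ) :
    Measurable fun h : History D O t =>
      (f.law (A.act t h)).map fun o => Fin.snoc (α := fun _ => D × O) h (A.act t h, o) := by
  have key : Measurable fun p : History D O t × D =>
      (f.law p.2).map fun o => (Fin.snoc (α := fun _ => D × O) p.1 (p.2, o) : History D O (t + 1)) := by
    -- There are finitely many decisions, so joint measurability is checked for each fixed decision.
    refine measurable_from_prod_countable_left fun d => ?_
    have hm : Measurable fun p : History D O t × O =>
        (Fin.snoc (α := fun _ => D × O) p.1 (d, p.2) : History D O (t + 1)) :=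
      (measurable_snoc t).comp
        (measurable_fst.prodMk (measurable_const.prodMk measurable_snd))
    -- For fixed `d` the step pushes `f.law d` forward by `o ↦ (h, o)`, measurably in `h`, and then
    -- by a map that no longer depends on `h`.
    have := (Measure.measurable_map _ hm).comp
      (Measurable.map_prodMk_left (α := History D O t) (ν := f.law d))
    convert this using 2 with h
    exact (Measure.map_map hm measurable_prodMk_left).symm
  exact key.comp (measurable_id.prodMk (A.measurable_act t))

theorem lintegral_historyLaw_succ (f : Instance D ν) (A : Policy D O) (t : ℕ)
    {G : History D O (t + 1) → ℝ≥0∞} (hG : Measurable G) :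
    ∫⁻ h, G h ∂(historyLaw f A (t + 1)) = ∫⁻ h, ∫⁻ o,
      G (Fin.snoc (α := fun _ => D × O) h (A.act t h, o)) ∂(f.law (A.act t h))
        ∂(historyLaw f A t) := by
  rw [historyLaw, Measure.lintegral_bind (measurable_historyStep f A t).aemeasurable
    hG.aemeasurable]
  refine lintegral_congr fun h => ?_
  rw [lintegral_map hG]
  exact (measurable_snoc t).comp (measurable_const.prodMk (measurable_const.prodMk measurable_id))

instance isProbabilityMeasure_historyLaw (f : Instance D ν) (A : Policy D O) (t : ℕ) :
    IsProbabilityMeasure (historyLaw f A t) := by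
  induction t with
  | zero => rw [historyLaw]; infer_instance
  | succ t ih =>
    constructor
    have := lintegral_historyLaw_succ f A t (G := fun _ => 1) measurable_const
    simpa using this

/-- The product over all rounds of nonnegative functions with conditional mean at most `1` has mean
at most `1`. -/
theorem lintegral_prod_historyLaw_le_one (f : Instance D ν) (A : Policy D O)
    {φ : ℕ → D → O → ℝ≥0∞} (hm : ∀ t d, Measurable (φ t d))
    (hφ : ∀ t d, ∫⁻ o, φ t d o ∂(f.law d) ≤ 1) (n : ℕ) :
    (Measurable fun h : History D O n => ∏ i : Fin n, φ i (h i).1 (h i).2) ∧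
    ∫⁻ h, ∏ i : Fin n, φ i (h i).1 (h i).2 ∂(historyLaw f A n) ≤ 1 := by
  have hmeas : ∀ n, Measurable fun h : History D O n => ∏ i : Fin n, φ i (h i).1 (h i).2 := by
    intro n
    refine Finset.measurable_prod _ fun i _ => ?_
    have : Measurable fun p : O × D => φ i p.2 p.1 :=
      measurable_from_prod_countable_left fun d => hm i d
    exact this.comp ((measurable_snd.comp (measurable_pi_apply i)).prodMk
      (measurable_fst.comp (measurable_pi_apply i)))
  refine ⟨hmeas n, ?_⟩
  induction n with
  | zero => simp
  | succ t ih =>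
    rw [lintegral_historyLaw_succ f A t (hmeas _)]
    refine le_trans (lintegral_mono fun h => ?_) ih
    simp only [Fin.prod_univ_castSucc, Fin.snoc_castSucc, Fin.snoc_last, Fin.val_castSucc,
      Fin.val_last]
    rw [lintegral_const_mul _ (hm _ _)]
    exact mul_le_of_le_one_right' (hφ _ _)

/-- Markov's inequality for the product over all rounds of nonnegative functions with conditional
mean at most `1`. -/
theorem exists_event_prod_lt (f : Instance D ν) (A : Policy D O)
    {φ : ℕ → D → O → ℝ≥0∞} (hm : ∀ t d, Measurable (φ t d))
    (hφ : ∀ t d, ∫⁻ o, φ t d o ∂(f.law d) ≤ 1) (n : ℕ) (r : ℝ) :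
    ∃ B : Set (History D O n), MeasurableSet B ∧ (historyLaw f A n).real B ≤ Real.exp (-r) ∧
      ∀ H : ℕ → D × O, (fun i : Fin n => H i) ∉ B →
        ∏ i ∈ Finset.range n, φ i (H i).1 (H i).2 < ENNReal.ofReal (Real.exp r) := by
  obtain ⟨h1, h2⟩ := lintegral_prod_historyLaw_le_one f A hm hφ n
  refine ⟨{h | ENNReal.ofReal (Real.exp r) ≤ ∏ i : Fin n, φ i (h i).1 (h i).2},
    measurableSet_le measurable_const h1, ?_, fun H hH => ?_⟩
  · have h3 := meas_ge_le_lintegral_div (μ := historyLaw f A n) h1.aemeasurable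
      (ε := ENNReal.ofReal (Real.exp r)) (by simp [Real.exp_pos]) ENNReal.ofReal_ne_top
    have h4 : historyLaw f A n {h | ENNReal.ofReal (Real.exp r) ≤
        ∏ i : Fin n, φ i (h i).1 (h i).2} ≤ ENNReal.ofReal (Real.exp (-r)) := by
      refine h3.trans ((ENNReal.div_le_div_right h2 _).trans ?_)
      rw [one_div, ← ENNReal.ofReal_inv_of_pos (Real.exp_pos r), Real.exp_neg]
    exact ENNReal.toReal_le_of_le_ofReal (Real.exp_pos _).le h4
  · rw [Set.mem_ofPred_eq, not_le,
      Fin.prod_univ_eq_prod_range (fun i => φ i (H i).1 (H i).2) n] at hH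
    exact hH

/-- Almost surely the decisions follow the policy, and every observation has each property that
holds almost surely under the law of its decision. -/
theorem ae_historyLaw (f : Instance D ν) (A : Policy D O) {P : D → O → Prop}
    (hm : ∀ d, MeasurableSet {o | P d o}) (hP : ∀ d, ∀ᵐ o ∂(f.law d), P d o) (n : ℕ) :
    ∀ᵐ h ∂(historyLaw f A n), ∀ i : Fin n, P (h i).1 (h i).2 ∧
      (h i).1 = A.act i (fun j : Fin i => h (Fin.castLE i.2.le j)) := by
  have hmeas : ∀ n, MeasurableSet {h : History D O n | ∀ i : Fin n, P (h i).1 (h i).2 ∧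
      (h i).1 = A.act i (fun j : Fin i => h (Fin.castLE i.2.le j))} := by
    intro n
    simp only [Set.ofPred_forall]
    refine MeasurableSet.iInter fun i => MeasurableSet.inter ?_ ?_
    · have : MeasurableSet {p : O × D | P p.2 p.1} := by
        have h1 : Measurable fun p : O × D => P p.2 p.1 :=
          measurable_from_prod_countable_left fun d => measurableSet_setOfPred.1 (hm d)
        exact measurableSet_setOfPred.2 h1
      exact this.preimage ((measurable_snd.comp (measurable_pi_apply i)).prodMk
        (measurable_fst.comp (measurable_pi_apply i)))
    · refine measurableSet_eq_fun (measurable_fst.comp (measurable_pi_apply i))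
        ((A.measurable_act i).comp ?_)
      exact measurable_pi_iff.2 fun j => measurable_pi_apply _
  induction n with
  | zero => exact ae_of_all _ fun h i => i.elim0
  | succ t ih =>
    -- The exceptional set is integrated one round at a time: after a good history its indicator
    -- vanishes for almost every next observation.
    rw [ae_iff, ← Set.compl_ofPred, ← lintegral_indicator_one (hmeas (t + 1)).compl,
      lintegral_historyLaw_succ f A t
        (measurable_one.indicator (hmeas (t + 1)).compl)]
    refine (lintegral_congr_ae (g := 0) ?_).trans (by simp)
    filter_upwards [ih] with h hh
    refine (lintegral_congr_ae (g := 0) ?_).trans (by simp)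
    filter_upwards [hP (A.act t h)] with o ho
    simp only [Pi.zero_apply]
    rw [Set.indicator_of_notMem]
    rw [Set.notMem_compl_iff]
    intro i
    refine Fin.lastCases ?_ (fun j => ?_) i
    · simp only [Fin.snoc_last]
      refine ⟨ho, ?_⟩
      congr 1
      funext j
      exact (Fin.snoc_castSucc (α := fun _ => D × O) (A.act t h, o) h j).symm
    · simp only [Fin.snoc_castSucc]
      refine ⟨(hh j).1, (hh j).2.trans ?_⟩
      show A.act j _ = A.act j _
      congr 1
      funext k
      exact (Fin.snoc_castSucc (α := fun _ => D × O) (A.act t h, o) h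
        (Fin.castLE j.2.le k)).symm

end HistoryLaw

/-! ### Quantities that depend only on the laws; gaps -/

section Instances

variable {D O : Type*} [MeasurableSpace O] {ν : Measure O}

theorem meanReward_congr (R : O → ℝ) {f g : Instance D ν} (h : f.law = g.law) :
    meanReward R f = meanReward R g := by
  funext π; rw [meanReward, meanReward, h]

theorem kl_congr {f f' : Instance D ν} (h : f.law = f'.law) (g : Instance D ν) :
    kl f g = kl f' g := by
  funext π; rw [kl, kl, h]

theorem kl_eq_zero_iff (f g : Instance D ν) (π : D) : kl f g π = 0 ↔ f.law π = g.law π :=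
  InformationTheory.klDiv_eq_zero_iff

theorem exists_kl_ne_zero {f g : Instance D ν} (h : f.law ≠ g.law) : ∃ π, kl f g π ≠ 0 := by
  by_contra! hc
  exact h (funext fun π => (kl_eq_zero_iff f g π).1 (hc π))

theorem ae_density_ne_zero (f : Instance D ν) (π : D) :
    ∀ᵐ o ∂(f.law π), f.density π o ≠ 0 := by
  rw [Instance.law, ae_withDensity_iff (f.measurable_density π)]
  exact ae_of_all _ fun o ho => ho

theorem ae_density_eq {f g : Instance D ν} (h : f.law = g.law) (π : D) :
    ∀ᵐ o ∂(f.law π), g.density π o = f.density π o := by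
  have h1 : f.density π =ᵐ[ν] g.density π :=
    (withDensity_eq_iff (f.measurable_density π).aemeasurable
      (g.measurable_density π).aemeasurable (by simp [f.lintegral_density])).1 (congrFun h π)
  have h2 : f.law π ≪ ν := withDensity_absolutelyContinuous _ _
  filter_upwards [h2.ae_le h1] with o ho using ho.symm

variable [Finite D] [Nonempty D]

/-- The maximizer is chosen from a statement about the function `meanReward R f` alone, so equal
mean rewards give the same choice, whatever the ties. -/
theorem optDecision_congr (R : O → ℝ) {f g : Instance D ν} (h : f.law = g.law) :
    optDecision R f = optDecision R g := by
  unfold optDecision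
  congr 1
  funext π
  rw [meanReward_congr R h]

theorem gap_congr (R : O → ℝ) {f g : Instance D ν} (h : f.law = g.law) :
    gap R f = gap R g := by
  funext π
  rw [gap, gap, optDecision_congr R h, meanReward_congr R h]

theorem meanReward_le_optDecision (R : O → ℝ) (f : Instance D ν) (π : D) :
    meanReward R f π ≤ meanReward R f (optDecision R f) :=
  (Finite.exists_max (meanReward R f)).choose_spec π

theorem gap_nonneg (R : O → ℝ) (f : Instance D ν) (π : D) : 0 ≤ gap R f π :=
  sub_nonneg.2 (meanReward_le_optDecision R f π)

theorem gap_optDecision (R : O → ℝ) (f : Instance D ν) : gap R f (optDecision R f) = 0 :=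
  sub_self _

theorem iSup_meanReward (R : O → ℝ) (f : Instance D ν) :
    ⨆ π, meanReward R f π = meanReward R f (optDecision R f) :=
  le_antisymm (ciSup_le (meanReward_le_optDecision R f))
    (le_ciSup (Set.finite_range (meanReward R f)).bddAbove _)

theorem gap_le {R : O → ℝ} {Rmax : ℝ} (hR : Measurable R) {f : Instance D ν}
    (hbdd : ∀ π, ∀ᵐ o ∂(f.law π), 0 ≤ R o ∧ R o ≤ Rmax) (π : D) : gap R f π ≤ Rmax := by
  have hintegrable : ∀ π, Integrable R (f.law π) := fun π =>
    Integrable.of_mem_Icc 0 Rmax hR.aemeasurable (hbdd π)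
  have h1 : meanReward R f (optDecision R f) ≤ Rmax := by
    have := integral_mono_ae (hintegrable (optDecision R f)) (integrable_const Rmax)
      ((hbdd _).mono fun o ho => ho.2)
    simpa [meanReward] using this
  have h2 : 0 ≤ meanReward R f π := integral_nonneg_of_ae ((hbdd π).mono fun o ho => ho.1)
  rw [gap]; linarith

end Instances

/-! ### Moments of likelihood ratios and Condition 1 -/

section Affinity

variable {D O : Type*} [MeasurableSpace O] {ν : Measure O}

/-- A change of measure. Only an inequality holds in general: where `f` has density `0` the left
side sees nothing, while at `lam = 1` the right side keeps the mass of `g`. The case `lam = 1` is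
needed for false acceptance. -/
theorem lintegral_ratio_rpow_le (f g : Instance D ν) (π : D) {lam : ℝ} (h0 : 0 < lam) :
    ∫⁻ o, (g.density π o / f.density π o) ^ lam ∂(f.law π) ≤
      ∫⁻ o, f.density π o ^ (1 - lam) * g.density π o ^ (1 - (1 - lam)) ∂ν := by
  have hm : Measurable fun o => (g.density π o / f.density π o) ^ lam :=
    ((g.measurable_density π).div (f.measurable_density π)).pow_const _
  rw [Instance.law, lintegral_withDensity_eq_lintegral_mul _ (f.measurable_density π) hm]
  refine lintegral_mono fun o => ?_
  simp only [Pi.mul_apply, sub_sub_cancel]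
  by_cases hf : f.density π o = 0
  · simp [hf]
  have hf' := f.density_ne_top π o
  rw [ENNReal.div_rpow_of_nonneg _ _ h0.le, div_eq_mul_inv, ← ENNReal.rpow_neg,
    mul_comm (g.density π o ^ lam), ← mul_assoc]
  gcongr
  nth_rewrite 1 [← ENNReal.rpow_one (f.density π o)]
  rw [← ENNReal.rpow_add _ _ hf hf', ← sub_eq_add_neg]

/-- Hölder's inequality for two probability densities. -/
theorem lintegral_affinity_le_one (f g : Instance D ν) (π : D) {lam : ℝ} (h0 : 0 < lam)
    (h1 : lam ≤ 1) :
    ∫⁻ o, f.density π o ^ (1 - lam) * g.density π o ^ (1 - (1 - lam)) ∂ν ≤ 1 := by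
  refine (ENNReal.lintegral_mul_norm_pow_le (f.measurable_density π).aemeasurable
    (g.measurable_density π).aemeasurable (by linarith) (by linarith) (by ring)).trans ?_
  simp [f.lintegral_density, g.lintegral_density]

theorem lintegral_affinity_le_exp (f g : Instance D ν) (π : D) {lam : ℝ} (h0 : 0 < lam)
    {m : ℝ} (hm : (m : EReal) ≤ renyi (1 - lam) f g π) :
    ∫⁻ o, f.density π o ^ (1 - lam) * g.density π o ^ (1 - (1 - lam)) ∂ν ≤
      ENNReal.ofReal (Real.exp (-(lam * m))) := by
  unfold renyi at hm
  set I := ∫⁻ o, f.density π o ^ (1 - lam) * g.density π o ^ (1 - (1 - lam)) ∂ν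
  have hneg : ((1 - lam - 1)⁻¹ : ℝ) < 0 := by
    rw [inv_lt_zero]; linarith
  rcases eq_or_ne I 0 with hI | hI
  · simp [hI]
  -- An infinite integral would make the Rényi divergence `⊥`, against the real lower bound `m`.
  rcases eq_or_ne I ∞ with hI' | hI'
  · rw [hI', ENNReal.log_top, EReal.coe_mul_top_of_neg hneg] at hm
    simp at hm
  have hpos : 0 < I.toReal := ENNReal.toReal_pos hI hI'
  rw [← ENNReal.ofReal_toReal hI', ENNReal.log_ofReal_of_pos hpos, ← EReal.coe_mul,
    EReal.coe_le_coe_iff] at hm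
  rw [← ENNReal.ofReal_toReal hI']
  refine ENNReal.ofReal_le_ofReal ?_
  rw [← Real.log_le_iff_le_exp hpos]
  have h2 : (1 - lam - 1 : ℝ)⁻¹ = -(1 / lam) := by
    rw [show (1 - lam - 1 : ℝ) = -lam by ring, inv_neg, one_div]
  rw [h2] at hm
  have h3 : lam * m ≤ lam * (-(1 / lam) * Real.log I.toReal) := by gcongr
  have h4 : lam * (-(1 / lam) * Real.log I.toReal) = - Real.log I.toReal := by
    field_simp
  linarith

/-- The truncation `max 0 (min (D_KL(f[π] ‖ g[π]) - ε) α)` of the KL divergence. -/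
noncomputable def truncKL (f g : Instance D ν) (ε α : ℝ) (π : D) : ℝ :=
  if kl f g π = ∞ then α else max 0 (min ((kl f g π).toReal - ε) α)

theorem truncKL_nonneg (f g : Instance D ν) (ε : ℝ) {α : ℝ} (hα : 0 ≤ α) (π : D) :
    0 ≤ truncKL f g ε α π := by
  unfold truncKL; split_ifs
  exacts [hα, le_max_left _ _]

theorem lintegral_ratio_rpow_le_exp_truncKL (f g : Instance D ν) (π : D) {lam ε α : ℝ}
    (h0 : 0 < lam) (h1 : lam < 1)
    (h : min ((kl f g π : EReal) - (ε : EReal)) (α : EReal) ≤ renyi (1 - lam) f g π) :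
    ∫⁻ o, (g.density π o / f.density π o) ^ lam ∂(f.law π) ≤
      ENNReal.ofReal (Real.exp (-(lam * truncKL f g ε α π))) := by
  refine (lintegral_ratio_rpow_le f g π h0).trans ?_
  unfold truncKL
  split_ifs with hk
  · refine lintegral_affinity_le_exp f g π h0 (le_trans ?_ h)
    simp [hk]
  · rcases le_total 0 (min ((kl f g π).toReal - ε) α) with hm | hm
    · rw [max_eq_right hm]
      refine lintegral_affinity_le_exp f g π h0 (le_trans (le_of_eq ?_) h)
      rw [EReal.coe_strictMono.monotone.map_min, EReal.coe_sub, EReal.coe_ennreal_toReal hk]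
    -- When the truncation clips a negative value to `0`, Hölder's bound by `1` suffices.
    · rw [max_eq_left hm]
      simpa using lintegral_affinity_le_one f g π h0 h1.le

/-- The form in which Condition 1 enters the proof. Finiteness of `F` allows a single `ι`, the
minimum over the class. -/
theorem UniformRenyiConvergence.exists_rate {F : Finset (Instance D ν)}
    (h : UniformRenyiConvergence F) :
    ∃ c₁ c₂ c₃ ι : ℝ, 0 < c₁ ∧ 0 < c₂ ∧ 0 < c₃ ∧ 0 < ι ∧
      ∀ α ε lam : ℝ, 0 < α → 0 < ε → ε < 1 → 0 < lam → lam < 1 →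
        lam ≤ ε ^ c₁ * min (1 / α) c₂ ^ c₃ * ι → ∀ f ∈ F, ∀ g ∈ F, ∀ π,
        ∫⁻ o, (g.density π o / f.density π o) ^ lam ∂(f.law π) ≤
          ENNReal.ofReal (Real.exp (-(lam * truncKL f g ε α π))) := by
  obtain ⟨c₁, c₂, c₃, ι, lam₀, h1, h2, h3, hι, H⟩ := h
  obtain ⟨ι₀, hι₀, hle⟩ : ∃ ι₀ : ℝ, 0 < ι₀ ∧ ∀ f ∈ F, ι₀ ≤ ι f := by
    rcases F.eq_empty_or_nonempty with rfl | hne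
    · exact ⟨1, one_pos, by simp⟩
    · obtain ⟨f, hf, hmin⟩ := F.exists_min_image ι hne
      exact ⟨ι f, hι f hf, hmin⟩
  refine ⟨c₁, c₂, c₃, ι₀, h1, h2, h3, hι₀, ?_⟩
  intro α ε lam hα hε hε1 hl hl1 hlam f hf g hg π
  obtain ⟨h4, h5⟩ := H α hα ε hε hε1 f hf
  refine lintegral_ratio_rpow_le_exp_truncKL f g π hl hl1 (h5 lam hl hl1 ?_ g hg π)
  refine hlam.trans (le_trans ?_ h4)
  have : 0 < min (1 / α) c₂ := lt_min (by positivity) h2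
  gcongr
  exact hle f hf

end Affinity

/-! ### The program defining the complexity -/

section Complexity

variable {D O : Type*} [MeasurableSpace O] {ν : Measure O} [Fintype D] [Nonempty D]

theorem cost_congr (R : O → ℝ) {f g : Instance D ν} (h : f.law = g.law) :
    cost R f = cost R g := by
  funext w; simp only [cost, gap_congr R h]

theorem isFeasible_congr (R : O → ℝ) (F : Finset (Instance D ν)) {f g : Instance D ν}
    (h : f.law = g.law) : IsFeasible R F f = IsFeasible R F g := by
  funext N w; simp only [IsFeasible, optDecision_congr R h, kl_congr h]

theorem cost_nonneg (R : O → ℝ) (f : Instance D ν) (w : D → ℝ≥0) : 0 ≤ cost R f w :=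
  Finset.sum_nonneg fun π _ => mul_nonneg (w π).2 (gap_nonneg R f π)

theorem complexityAt_nonneg (R : O → ℝ) (F : Finset (Instance D ν)) (f : Instance D ν) (N : ℝ) :
    0 ≤ complexityAt R F f N :=
  le_iInf₂ fun w _ => EReal.coe_nonneg.2 (cost_nonneg R f w)

theorem antitone_complexityAt (R : O → ℝ) (F : Finset (Instance D ν)) (f : Instance D ν) :
    Antitone (complexityAt R F f) := by
  intro N N' hN
  refine le_iInf₂ fun w hw => iInf₂_le w ⟨hw.1, fun π => (hw.2 π).trans hN⟩

/-- Raising the cap enlarges the feasible set, so the value is antitone in `N` and converges to its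
infimum in the extended reals. -/
theorem tendsto_complexityAt (R : O → ℝ) (F : Finset (Instance D ν)) (f : Instance D ν) :
    Tendsto (fun N : ℝ => complexityAt R F f N) atTop (𝓝 (complexity R F f)) := by
  have h := tendsto_atTop_iInf (antitone_complexityAt R F f)
  rw [complexity, h.limUnder_eq]
  exact h

/-- Weight `N` on every decision is feasible for large `N`: instances with different optimal
decisions differ in some law, so some divergence is nonzero and its multiple by `N` grows without
bound. Finiteness of `F` makes the threshold uniform. -/
theorem eventually_exists_isFeasible (R : O → ℝ) (F : Finset (Instance D ν)) :
    ∀ᶠ N : ℝ in atTop, ∀ f ∈ F, ∃ w, IsFeasible R F f N w := by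
  have key : ∀ f ∈ F, ∀ g ∈ F, ∀ᶠ N : ℝ in atTop,
      optDecision R g ≠ optDecision R f → 1 ≤ ∑ π, (N.toNNReal : ℝ≥0∞) * kl f g π := by
    intro f _ g _
    by_cases hne : optDecision R g = optDecision R f
    · exact Eventually.of_forall fun N hc => absurd hne hc
    obtain ⟨π, hπ⟩ := exists_kl_ne_zero fun h => hne (optDecision_congr R h).symm
    have h1 : Tendsto (fun N : ℝ => (N.toNNReal : ℝ≥0∞) * kl f g π) atTop (𝓝 (∞ * kl f g π)) :=
      ENNReal.Tendsto.mul_const (ENNReal.tendsto_coe_nhds_top.2 tendsto_real_toNNReal_atTop)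
        (Or.inl (by simp))
    rw [ENNReal.top_mul hπ] at h1
    filter_upwards [h1.eventually (lt_mem_nhds ENNReal.one_lt_top)] with N hN _
    exact hN.le.trans (Finset.single_le_sum (f := fun π => (N.toNNReal : ℝ≥0∞) * kl f g π)
      (fun _ _ => zero_le) (Finset.mem_univ π))
  have h2 := (F.eventually_all).2 fun f hf => (F.eventually_all).2 fun g hg => key f hf g hg
  filter_upwards [h2, eventually_ge_atTop 0] with N hN h0 f hf
  refine ⟨fun _ => N.toNNReal, hN f hf, fun π => ?_⟩
  rw [Real.coe_toNNReal _ h0]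

theorem complexity_ne_top (R : O → ℝ) {F : Finset (Instance D ν)} {f : Instance D ν}
    (hf : f ∈ F) : complexity R F f ≠ ⊤ := by
  obtain ⟨N, hN⟩ := (eventually_exists_isFeasible R F).exists
  obtain ⟨w, hw⟩ := hN f hf
  have h1 : complexity R F f ≤ complexityAt R F f N :=
    le_of_tendsto (tendsto_complexityAt R F f)
      ((eventually_ge_atTop N).mono fun N' hN' => antitone_complexityAt R F f hN')
  have h2 : complexityAt R F f N ≤ (cost R f w : EReal) := iInf₂_le w hw
  exact ((h1.trans h2).trans_lt (EReal.coe_lt_top _)).ne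

theorem cost_le_of_isSolution {R : O → ℝ} {F : Finset (Instance D ν)} {f : Instance D ν} {N : ℝ}
    {η : ℝ≥0} {w : D → ℝ≥0} (h : IsSolution R F f N η w) :
    cost R f w ≤ (complexityAt R F f N).toReal + η := by
  have h1 : complexityAt R F f N ≤ (cost R f w : EReal) := iInf₂_le w h.1
  have h2 : ((cost R f w - η : ℝ) : EReal) ≤ complexityAt R F f N :=
    le_iInf₂ fun w' hw' => EReal.coe_le_coe_iff.2 (by linarith [h.2 w' hw'])
  have h3 := EReal.toReal_le_toReal h2 (EReal.coe_ne_bot _)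
    (h1.trans_lt (EReal.coe_lt_top _)).ne
  rw [EReal.toReal_coe] at h3
  linarith

/-- A feasible point, scaled up slightly and mixed with the uniform weights, satisfies the
constraints with a margin for the truncated divergences. -/
theorem one_add_le_sum_mul_truncKL {R : O → ℝ} {F : Finset (Instance D ν)} {f g : Instance D ν}
    {N : ℝ} (hN : 1 ≤ N) {w : D → ℝ≥0} (hw : IsFeasible R F f N w) (hg : g ∈ F)
    (hne : optDecision R g ≠ optDecision R f) {ε : ℝ}
    (hε : ε = 1 / (4 * Fintype.card D * N ^ 2)) :
    1 + 1 / (2 * N) ≤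
      ∑ π, ((1 + 1 / N) * w π + 1 / N) * truncKL f g ε (2 * N) π := by
  have hN0 : 0 < N := by linarith
  have hK : (0 : ℝ) < Fintype.card D := by exact_mod_cast Fintype.card_pos
  have hε0 : 0 < ε := by rw [hε]; positivity
  have hnn : ∀ π, 0 ≤ ((1 + 1 / N) * w π + 1 / N) * truncKL f g ε (2 * N) π := fun π =>
    mul_nonneg (by positivity) (truncKL_nonneg f g ε (by positivity) π)
  have h1N : 1 / N ≤ 1 := by rw [div_le_one hN0]; exact hN
  have h2N : 1 / (2 * N) ≤ 1 := by rw [div_le_one (by positivity)]; linarith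
  -- If some divergence reaches the cap `2N`, its uniform share `1/N` alone contributes `2`.
  by_cases hc : ∃ π, truncKL f g ε (2 * N) π = 2 * N
  · obtain ⟨π, hπ⟩ := hc
    refine le_trans ?_ (Finset.single_le_sum (fun π _ => hnn π) (Finset.mem_univ π))
    rw [hπ]
    have h2 : 1 / N * (2 * N) ≤ ((1 + 1 / N) * w π + 1 / N) * (2 * N) := by
      gcongr
      have : 0 ≤ (1 + 1 / N) * (w π : ℝ) := by positivity
      linarith
    have h3 : 1 / N * (2 * N) = 2 := by field_simp
    linarith
  push Not at hc
  have hfin : ∀ π, kl f g π ≠ ∞ := fun π hπ => hc π (by simp [truncKL, hπ])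
  have hlow : ∀ π, (kl f g π).toReal - ε ≤ truncKL f g ε (2 * N) π := by
    intro π
    have h2 := hc π
    rw [truncKL, if_neg (hfin π)] at h2 ⊢
    rcases le_total ((kl f g π).toReal - ε) (2 * N) with h3 | h3
    · rw [min_eq_left h3]; exact le_max_right _ _
    · rw [min_eq_right h3, max_eq_right (by positivity)] at h2
      exact absurd rfl h2
  have hsum : 1 ≤ ∑ π, (w π : ℝ) * (kl f g π).toReal := by
    have h2 := hw.1 g hg hne
    have h3 := ENNReal.toReal_mono (ENNReal.sum_ne_top.2 fun π _ =>
      ENNReal.mul_ne_top ENNReal.coe_ne_top (hfin π)) h2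
    rw [ENNReal.toReal_sum fun π _ => ENNReal.mul_ne_top ENNReal.coe_ne_top (hfin π)] at h3
    simpa using h3
  -- The choice of `ε`: with `w π ≤ N`, the total loss from subtracting it is at most `|D| N ε =
  -- 1/(4N)`.
  have hwsum : ∑ π, (w π : ℝ) * ε ≤ 1 / (4 * N) := by
    calc ∑ π, (w π : ℝ) * ε ≤ ∑ _π : D, N * ε := by
          gcongr with π; exact hw.2 π
      _ = 1 / (4 * N) := by
          rw [Finset.sum_const, Finset.card_univ, nsmul_eq_mul, hε]; field_simp
  calc 1 + 1 / (2 * N) ≤ (1 + 1 / N) * (1 - 1 / (4 * N)) := by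
        have : (1 + 1 / N) * (1 - 1 / (4 * N)) - (1 + 1 / (2 * N)) =
            (1 / (4 * N)) * (1 - 1 / N) := by field_simp; ring
        have h2 : 0 ≤ (1 / (4 * N)) * (1 - 1 / N) := mul_nonneg (by positivity) (by linarith)
        linarith
    _ ≤ (1 + 1 / N) * ∑ π, (w π : ℝ) * ((kl f g π).toReal - ε) := by
        gcongr
        simp only [mul_sub, Finset.sum_sub_distrib]
        linarith
    _ ≤ _ := by
        rw [Finset.mul_sum]
        refine Finset.sum_le_sum fun π _ => ?_
        have h2 : (w π : ℝ) * ((kl f g π).toReal - ε) ≤ w π * truncKL f g ε (2 * N) π := by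
          gcongr; exact hlow π
        have h3 : 0 ≤ 1 / N * truncKL f g ε (2 * N) π :=
          mul_nonneg (by positivity) (truncKL_nonneg f g ε (by positivity) π)
        have h4 := mul_le_mul_of_nonneg_left h2 (by positivity : 0 ≤ 1 + 1 / N)
        linarith [add_mul ((1 + 1 / N) * (w π : ℝ)) (1 / N) (truncKL f g ε (2 * N) π),
          mul_assoc (1 + 1 / N) (w π : ℝ) (truncKL f g ε (2 * N) π)]

end Complexity

/-! ### Typical realizations and union bounds -/

section Paths

variable {D O : Type*} [MeasurableSpace O] {ν : Measure O} [MeasurableSpace D]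

/-- Almost sure properties of a realization `H` of the first `n` rounds: the decisions follow the
policy, the observations have positive density under `f`, and the densities of all instances in `F`
with the same laws as `f` agree with that of `f`. -/
structure IsTypicalPath (F : Finset (Instance D ν)) (f : Instance D ν) (A : Policy D O) (n : ℕ)
    (H : ℕ → D × O) : Prop where
  act : ∀ t < n, (H t).1 = A.act t (fun i : Fin t => H i)
  density_ne_zero : ∀ t < n, f.density (H t).1 (H t).2 ≠ 0
  density_eq : ∀ g ∈ F, f.law = g.law → ∀ t < n,
    g.density (H t).1 (H t).2 = f.density (H t).1 (H t).2

/-- Histories are read as restrictions of one infinite sequence `H`, so that prefixes of all lengths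
share the same indexing. Nothing is asked of `H` beyond round `n`. -/
theorem ae_isTypicalPath [Fintype D] [DiscreteMeasurableSpace D] (F : Finset (Instance D ν))
    (f : Instance D ν) (A : Policy D O) (n : ℕ) :
    ∀ᵐ h ∂(historyLaw f A n), ∀ H : ℕ → D × O, h = (fun i : Fin n => H i) →
      IsTypicalPath F f A n H := by
  have hm : ∀ d, MeasurableSet {o | f.density d o ≠ 0 ∧
      ∀ g ∈ F, f.law = g.law → g.density d o = f.density d o} := by
    intro d
    refine MeasurableSet.inter
      ((f.measurable_density d) (measurableSet_singleton 0).compl) ?_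
    change MeasurableSet {o | ∀ g ∈ F, f.law = g.law → g.density d o = f.density d o}
    simp only [Set.ofPred_forall]
    refine F.measurableSet_biInter fun g _ => MeasurableSet.iInter fun _ => ?_
    exact measurableSet_eq_fun (g.measurable_density d) (f.measurable_density d)
  have hP : ∀ d, ∀ᵐ o ∂(f.law d), f.density d o ≠ 0 ∧
      ∀ g ∈ F, f.law = g.law → g.density d o = f.density d o := by
    intro d
    refine (ae_density_ne_zero f d).and ?_
    refine (ae_ball_iff F.countable_toSet).2 fun g _ => ?_
    by_cases hg : f.law = g.law
    · filter_upwards [ae_density_eq hg d] with o ho _ using ho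
    · exact ae_of_all _ fun o ho => absurd ho hg
  filter_upwards [ae_historyLaw f A hm hP n] with h hh H hH
  subst hH
  exact ⟨fun t ht => (hh ⟨t, ht⟩).2, fun t ht => (hh ⟨t, ht⟩).1.1,
    fun g hg hgl t ht => (hh ⟨t, ht⟩).1.2 g hg hgl⟩

/-- The union bound. It is applied with `x` in place of a random quantity, such as the estimate or a
number of plays, and with a `Q` that assumes or excludes that this quantity equals `x`. -/
theorem exists_event_forall {n : ℕ} {μ : Measure (History D O n)} {ι : Type*}
    (s : Finset ι) {b : ℝ} {Q : ι → (ℕ → D × O) → Prop}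
    (h : ∀ x ∈ s, ∃ B : Set (History D O n), MeasurableSet B ∧ μ.real B ≤ b ∧
      ∀ H : ℕ → D × O, (fun i : Fin n => H i) ∉ B → Q x H) :
    ∃ B : Set (History D O n), MeasurableSet B ∧ μ.real B ≤ s.card * b ∧
      ∀ H : ℕ → D × O, (fun i : Fin n => H i) ∉ B → ∀ x ∈ s, Q x H := by
  choose! B hB using h
  refine ⟨⋃ x ∈ s, B x, s.measurableSet_biUnion fun x hx => (hB x hx).1, ?_, ?_⟩
  · refine (measureReal_biUnion_finset_le s B).trans
      ((Finset.sum_le_sum fun x hx => (hB x hx).2.1).trans ?_)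
    rw [Finset.sum_const, nsmul_eq_mul]
  · intro H hH x hx
    refine (hB x hx).2.2 H fun hc => hH ?_
    exact Set.mem_biUnion (by exact hx) hc

end Paths

theorem sum_Ico_eq_sum_count {D O : Type*} [Fintype D] [DecidableEq D] {H : ℕ → D × O} {a : ℕ} {l : List D}
    (hl : ∀ j (hj : j < l.length), (H (a + j)).1 = l[j]) (x : D → ℝ) :
    ∑ i ∈ Finset.Ico a (a + l.length), x (H i).1 = ∑ π, (l.count π : ℝ) * x π := by
  rw [Finset.sum_Ico_eq_sum_range, Nat.add_sub_cancel_left, Finset.sum_range]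
  have h1 : ∀ i : Fin l.length, x (H (a + i)).1 = x l[(i : ℕ)] := fun i => by rw [hl i i.2]
  rw [Finset.sum_congr rfl fun i _ => h1 i, Fin.sum_univ_fun_getElem, Finset.sum_list_map_count]
  refine (Finset.sum_subset (Finset.subset_univ _) fun π _ hπ => ?_).trans
    (Finset.sum_congr rfl fun π _ => nsmul_eq_mul _ _)
  rw [List.count_eq_zero.2 (by simpa using hπ), zero_smul]

/-! ### Likelihood ratios as products -/

section Likelihood

variable {D O : Type*} [MeasurableSpace O] {ν : Measure O}

/-- This holds for all values because `0 * ∞ = 0` in `ℝ≥0∞` matches `⊥ + ⊤ = ⊥` in `EReal`; the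
conventions of the test are thus those of a product. -/
theorem log_prod {ι : Type*} (s : Finset ι) (x : ι → ℝ≥0∞) :
    ENNReal.log (∏ i ∈ s, x i) = ∑ i ∈ s, ENNReal.log (x i) := by
  classical
  induction s using Finset.induction_on with
  | empty => simp
  | insert i s hi ih => rw [Finset.prod_insert hi, Finset.sum_insert hi, ENNReal.log_mul_add, ih]

theorem logLikelihood_eq (f : Instance D ν) (H : ℕ → D × O) (t : ℕ) :
    logLikelihood f (fun i : Fin t => H i) =
      ENNReal.log (∏ i ∈ Finset.range t, f.density (H i).1 (H i).2) := by
  rw [log_prod, logLikelihood,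
    Fin.sum_univ_eq_sum_range (fun i => ENNReal.log (f.density (H i).1 (H i).2)) t]

theorem sum_fin_filter_eq_sum_Ico {M : Type*} [AddCommMonoid M] (x : ℕ → M) {a b t : ℕ}
    (hb : b ≤ t) :
    ∑ i ∈ Finset.univ.filter (fun i : Fin t => a ≤ (i : ℕ) ∧ (i : ℕ) < b), x i =
      ∑ i ∈ Finset.Ico a b, x i := by
  rw [Finset.sum_filter,
    Fin.sum_univ_eq_sum_range (fun i => if a ≤ i ∧ i < b then x i else 0) t, ← Finset.sum_filter]
  congr 1
  ext i
  simp only [Finset.mem_filter, Finset.mem_range, Finset.mem_Ico]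
  omega

theorem logLikelihoodRatio_eq (f g : Instance D ν) (H : ℕ → D × O) {a b t : ℕ} (hb : b ≤ t) :
    logLikelihoodRatio f g (fun i : Fin t => H i) a b =
      ENNReal.log (∏ i ∈ Finset.Ico a b,
        (f.density (H i).1 (H i).2 / g.density (H i).1 (H i).2)) := by
  rw [log_prod, logLikelihoodRatio]
  exact sum_fin_filter_eq_sum_Ico
    (fun i => ENNReal.log (f.density (H i).1 (H i).2 / g.density (H i).1 (H i).2)) hb

/-- The likelihood ratio of `g` against an instance `f` with the true laws is small on the rounds in
which the decisions of the list `l` are played. -/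
theorem exists_event_ratio_lt [Fintype D] [DecidableEq D] [MeasurableSpace D]
    [DiscreteMeasurableSpace D]
    (fstar : Instance D ν) (A : Policy D O) {f : Instance D ν} (hf : fstar.law = f.law)
    (g : Instance D ν) {lam : ℝ} (hlam : 0 ≤ lam) {x : D → ℝ}
    (hx : ∀ π, ∫⁻ o, (g.density π o / f.density π o) ^ lam ∂(f.law π) ≤
      ENNReal.ofReal (Real.exp (-x π))) (n a : ℕ) (l : List D) (hn : a + l.length ≤ n) (q : ℝ) :
    ∃ B : Set (History D O n), MeasurableSet B ∧
      (historyLaw fstar A n).real B ≤ Real.exp (q - ∑ π, (l.count π : ℝ) * x π) ∧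
      ∀ H : ℕ → D × O, (fun i : Fin n => H i) ∉ B →
        (∀ j (hj : j < l.length), (H (a + j)).1 = l[j]) →
        (∏ i ∈ Finset.Ico a (a + l.length),
          (g.density (H i).1 (H i).2 / f.density (H i).1 (H i).2)) ^ lam <
            ENNReal.ofReal (Real.exp (-q)) := by
  set b := a + l.length with hb
  have hmr : ∀ d, Measurable fun o => (g.density d o / f.density d o) ^ lam := fun d =>
    ((g.measurable_density d).div (f.measurable_density d)).pow_const _
  -- The factor `exp (x d)` compensates the decay of the moment, and rounds outside the window
  -- contribute `1`. On paths that follow `l` the compensators multiply to a deterministic number.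
  obtain ⟨B, hB, hP, hH⟩ := exists_event_prod_lt fstar A
    (φ := fun t d o => if a ≤ t ∧ t < b then
      (g.density d o / f.density d o) ^ lam * ENNReal.ofReal (Real.exp (x d)) else 1)
    (fun t d => by
      split_ifs
      exacts [(hmr d).mul_const _, measurable_const])
    (fun t d => by
      split_ifs
      · rw [lintegral_mul_const _ (hmr d), congrFun hf d]
        calc _ ≤ ENNReal.ofReal (Real.exp (-x d)) * ENNReal.ofReal (Real.exp (x d)) := by
              gcongr; exact hx d
          _ = 1 := by
              rw [← ENNReal.ofReal_mul (Real.exp_pos _).le, ← Real.exp_add]; simp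
      · simp) n (∑ π, (l.count π : ℝ) * x π - q)
  refine ⟨B, hB, hP.trans (by rw [neg_sub]), fun H hHB hl => ?_⟩
  have h1 := hH H hHB
  have h2 : (Finset.range n).filter (fun i => a ≤ i ∧ i < b) = Finset.Ico a b := by
    ext i
    simp only [Finset.mem_filter, Finset.mem_range, Finset.mem_Ico]
    omega
  rw [← Finset.prod_filter, h2, Finset.prod_mul_distrib,
    ← ENNReal.ofReal_prod_of_nonneg fun i _ => (Real.exp_pos _).le, ← Real.exp_sum,
    sum_Ico_eq_sum_count hl, ENNReal.prod_rpow_of_nonneg hlam] at h1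
  have h3 : ENNReal.ofReal (Real.exp (∑ π, (l.count π : ℝ) * x π - q)) =
      ENNReal.ofReal (Real.exp (-q)) * ENNReal.ofReal (Real.exp (∑ π, (l.count π : ℝ) * x π)) := by
    rw [← ENNReal.ofReal_mul (Real.exp_pos _).le, ← Real.exp_add]
    congr 2; ring
  rw [h3] at h1
  exact lt_of_mul_lt_mul_right' h1

end Likelihood

/-- Different laws give a nonzero divergence at some decision. With `α = 1` and `ε` at most half of
it when it is finite, a fixed `lam` works, so playing every decision `m` times separates `f` from
`g` at an exponential rate in `m`. -/
theorem UniformRenyiConvergence.exists_separation {D O : Type*} [MeasurableSpace O]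
    {ν : Measure O} [Fintype D] {F : Finset (Instance D ν)} (hF : UniformRenyiConvergence F)
    {f : Instance D ν} (hf : f ∈ F) :
    ∃ c : ℝ, 0 < c ∧ ∀ g ∈ F, f.law ≠ g.law → ∃ (lam : ℝ) (x : D → ℝ), 0 < lam ∧
      c ≤ ∑ π, x π ∧ ∀ π, ∫⁻ o, (g.density π o / f.density π o) ^ lam ∂(f.law π) ≤
        ENNReal.ofReal (Real.exp (-x π)) := by
  obtain ⟨c₁, c₂, c₃, ι, h1, h2, h3, hι, hrate⟩ := hF.exists_rate
  have key : ∀ g ∈ F, ∀ᶠ c : ℝ in 𝓝[>] 0, f.law ≠ g.law → ∃ (lam : ℝ) (x : D → ℝ), 0 < lam ∧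
      c ≤ ∑ π, x π ∧ ∀ π, ∫⁻ o, (g.density π o / f.density π o) ^ lam ∂(f.law π) ≤
        ENNReal.ofReal (Real.exp (-x π)) := by
    intro g hg
    by_cases hne : f.law = g.law
    · exact Eventually.of_forall fun c hc => absurd hne hc
    obtain ⟨π₀, hπ₀⟩ := exists_kl_ne_zero hne
    obtain ⟨ε, hε0, hε1, hpos⟩ : ∃ ε : ℝ, 0 < ε ∧ ε < 1 ∧ 0 < truncKL f g ε 1 π₀ := by
      by_cases htop : kl f g π₀ = ∞
      · exact ⟨1 / 2, by norm_num, by norm_num, by simp [truncKL, htop]⟩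
      · have hk : 0 < (kl f g π₀).toReal := ENNReal.toReal_pos hπ₀ htop
        refine ⟨min ((kl f g π₀).toReal / 2) (1 / 2), by positivity,
          (min_le_right _ _).trans_lt (by norm_num), ?_⟩
        rw [truncKL, if_neg htop]
        refine lt_max_of_lt_right (lt_min ?_ one_pos)
        have := min_le_left ((kl f g π₀).toReal / 2) (1 / 2)
        linarith
    have hmin : (0 : ℝ) < min (1 / 1) c₂ := lt_min (by norm_num) h2
    set lam : ℝ := min (1 / 2) (ε ^ c₁ * min (1 / 1) c₂ ^ c₃ * ι) with hlam
    have hl0 : 0 < lam := lt_min (by norm_num) (by positivity)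
    have hl1 : lam < 1 := (min_le_left _ _).trans_lt (by norm_num)
    have hS : 0 < ∑ π, lam * truncKL f g ε 1 π :=
      Finset.sum_pos' (fun π _ => mul_nonneg hl0.le (truncKL_nonneg f g ε zero_le_one π))
        ⟨π₀, Finset.mem_univ _, mul_pos hl0 hpos⟩
    have hev : ∀ᶠ c : ℝ in 𝓝[>] 0, c < ∑ π, lam * truncKL f g ε 1 π :=
      nhdsWithin_le_nhds (gt_mem_nhds hS)
    filter_upwards [hev] with c hc _
    exact ⟨lam, _, hl0, hc.le, fun π =>
      hrate 1 ε lam one_pos hε0 hε1 hl0 hl1 (min_le_right _ _) f hf g hg π⟩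
  obtain ⟨c, hc, hpos⟩ := ((F.eventually_all.2 key).and self_mem_nhdsWithin).exists
  exact ⟨c, hpos, hc⟩

theorem log_le_logLikelihoodRatio_iff {D O : Type*} [MeasurableSpace O] {ν : Measure O}
    {n : ℕ} {f g : Instance D ν} {H : ℕ → D × O} {s b t : ℕ}
    (hb : b ≤ t) (hn : 0 < n) :
    ((Real.log n : ℝ) : EReal) ≤ logLikelihoodRatio f g (fun i : Fin t => H i) s b ↔
      (n : ℝ≥0∞) ≤ ∏ i ∈ Finset.Ico s b,
        (f.density (H i).1 (H i).2 / g.density (H i).1 (H i).2) := by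
  rw [logLikelihoodRatio_eq f g H hb, ← ENNReal.log_ofReal_of_pos (by exact_mod_cast hn),
    ENNReal.log_le_log_iff, ENNReal.ofReal_natCast]

/-! ### Probabilities of a wrong estimate, a false acceptance and a false rejection -/

section Events

variable {D O : Type*} [MeasurableSpace O] {ν : Measure O} [Fintype D] [DecidableEq D]
  [Nonempty D] [MeasurableSpace D]
  {R : O → ℝ} {Rmax : ℝ} {F : Finset (Instance D ν)} {n : ℕ} {η : ℝ≥0}

/-- The maximum likelihood estimate on the realization `H`. -/
def TestToCommit.estimate (a : TestToCommit R Rmax F n η) (H : ℕ → D × O) : F :=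
  a.mle (fun i : Fin a.initList.length => H i)

/-- The first round after the identification step if `f` is the estimate. -/
def TestToCommit.testEnd (a : TestToCommit R Rmax F n η) (f : F) : ℕ :=
  a.initList.length + (a.identList f).length

theorem TestToCommit.path_init (a : TestToCommit R Rmax F n η) {f : Instance D ν}
    {H : ℕ → D × O} (hH : IsTypicalPath F f a.toPolicy n H) (hn : a.initList.length ≤ n)
    (j : ℕ) (hj : j < a.initList.length) : (H (0 + j)).1 = a.initList[j] := by
  rw [zero_add, hH.act j (by omega)]
  exact a.act_init j hj _

theorem TestToCommit.path_ident (a : TestToCommit R Rmax F n η) {f : Instance D ν}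
    {H : ℕ → D × O} (hH : IsTypicalPath F f a.toPolicy n H)
    (hn : a.testEnd (a.estimate H) ≤ n) (j : ℕ)
    (hj : j < (a.identList (a.estimate H)).length) :
    (H (a.initList.length + j)).1 = (a.identList (a.estimate H))[j] := by
  rw [hH.act _ (by rw [TestToCommit.testEnd] at hn; omega)]
  have := a.act_ident (a.initList.length + j) (by omega)
    (fun i => H i) (a.estimate H) rfl (by simpa using hj)
  rw [this]
  congr 1
  omega

variable [DiscreteMeasurableSpace D]

/-- With high probability the maximum likelihood estimate has the true laws. -/
theorem TestToCommit.exists_event_estimate (hF : UniformRenyiConvergence F)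
    {fstar : Instance D ν} (hfstar : fstar ∈ F) :
    ∃ c : ℝ, 0 < c ∧ ∀ (n : ℕ) (η : ℝ≥0) (a : TestToCommit R Rmax F n η),
      a.initList.length ≤ n → ∃ B : Set (History D O n), MeasurableSet B ∧
        (historyLaw fstar a.toPolicy n).real B ≤
          F.card * Real.exp (-(c * ⌈Real.log n / Real.log (Real.log n)⌉₊)) ∧
        ∀ H : ℕ → D × O, (fun i : Fin n => H i) ∉ B →
          IsTypicalPath F fstar a.toPolicy n H → fstar.law = (a.estimate H : Instance D ν).law := by
  obtain ⟨c, hc, hsep⟩ := hF.exists_separation hfstar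
  refine ⟨c, hc, fun n η a hn => ?_⟩
  have hE := exists_event_forall (μ := historyLaw fstar a.toPolicy n) F
    (b := Real.exp (-(c * ⌈Real.log n / Real.log (Real.log n)⌉₊)))
    (Q := fun g H => IsTypicalPath F fstar a.toPolicy n H → fstar.law ≠ g.law →
      (a.estimate H : Instance D ν) ≠ g) ?_
  · obtain ⟨B, hB, hP, hH⟩ := hE
    refine ⟨B, hB, hP, fun H hHB hpath => ?_⟩
    by_contra hne
    exact hH H hHB _ (a.estimate H).2 hpath hne rfl
  intro g hg
  by_cases hne : fstar.law = g.law
  · exact ⟨∅, MeasurableSet.empty, by simp [(Real.exp_pos _).le],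
      fun H _ _ h => absurd hne h⟩
  obtain ⟨lam, x, hl0, hS, hx⟩ := hsep g hg hne
  -- With `q = 0` the likelihood ratio of `g` against `fstar` is below `1`, which is impossible if
  -- `g` maximizes the likelihood.
  obtain ⟨B, hB, hP, hH⟩ := exists_event_ratio_lt fstar a.toPolicy rfl g hl0.le hx n 0 a.initList
    (by simpa using hn) 0
  refine ⟨B, hB, hP.trans (Real.exp_le_exp.2 ?_), fun H hHB hpath _ hest => ?_⟩
  · simp only [a.count_initList, ← Finset.mul_sum]
    rw [zero_sub, mul_comm c]
    gcongr
  have h1 := hH H hHB (a.path_init hpath hn)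
  rw [zero_add, ← Finset.range_eq_Ico, neg_zero, Real.exp_zero, ENNReal.ofReal_one] at h1
  refine absurd h1 (not_lt.2 (ENNReal.one_le_rpow ?_ hl0))
  have h2 := a.isMax_mle (fun i : Fin a.initList.length => H i) fstar hfstar
  change logLikelihood _ _ ≤ logLikelihood (a.estimate H : Instance D ν) _ at h2
  rw [hest, logLikelihood_eq, logLikelihood_eq, ENNReal.log_le_log_iff] at h2
  have hpos : ∀ i ∈ Finset.range a.initList.length, fstar.density (H i).1 (H i).2 ≠ 0 :=
    fun i hi => hpath.density_ne_zero i ((Finset.mem_range.1 hi).trans_le hn)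
  rw [ENNReal.prod_div_distrib fun i hi _ _ _ => Or.inl (hpos i hi),
    ENNReal.le_div_iff_mul_le (Or.inl (Finset.prod_ne_zero_iff.2 hpos))
      (Or.inl (ENNReal.prod_ne_top fun i _ => fstar.density_ne_top _ _)), one_mul]
  exact h2

/-- With high probability no instance with a wrong optimal decision is accepted. -/
theorem TestToCommit.exists_event_not_accepts {fstar : Instance D ν} (hfstar : fstar ∈ F)
    (a : TestToCommit R Rmax F n η) (hn : 0 < n) (hend : ∀ f, a.testEnd f ≤ n) :
    ∃ B : Set (History D O n), MeasurableSet B ∧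
      (historyLaw fstar a.toPolicy n).real B ≤ F.card * (1 / n) ∧
      ∀ H : ℕ → D × O, (fun i : Fin n => H i) ∉ B → IsTypicalPath F fstar a.toPolicy n H →
        optDecision R fstar ≠ optDecision R (a.estimate H : Instance D ν) →
        ∀ t, a.testEnd (a.estimate H) ≤ t →
          ¬ Accepts R F n (a.estimate H) (fun i : Fin t => H i) a.initList.length
            (a.testEnd (a.estimate H)) := by
  have hn' : (0 : ℝ) < n := by exact_mod_cast hn
  have hE := exists_event_forall (μ := historyLaw fstar a.toPolicy n)
    (Finset.univ : Finset F) (b := 1 / n)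
    (Q := fun g H => IsTypicalPath F fstar a.toPolicy n H → a.estimate H = g →
      ∏ i ∈ Finset.Ico a.initList.length (a.testEnd g),
        ((g : Instance D ν).density (H i).1 (H i).2 / fstar.density (H i).1 (H i).2) < n) ?_
  · obtain ⟨B, hB, hP, hH⟩ := hE
    refine ⟨B, hB, by simpa using hP, fun H hHB hpath hopt t ht hacc => ?_⟩
    have h1 := hH H hHB _ (Finset.mem_univ _) hpath rfl
    have h2 := hacc fstar hfstar hopt
    rw [log_le_logLikelihoodRatio_iff ht hn] at h2
    exact absurd h1 (not_lt.2 h2)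
  intro g _
  -- At exponent `1` the ratio has mean at most `1` under `fstar`; with `q = -ln n` Markov's
  -- inequality yields the probability `1/n`. Once the estimate is fixed to be `g`, the order of the
  -- identification rounds is deterministic.
  have hx : ∀ π, ∫⁻ o, ((g : Instance D ν).density π o / fstar.density π o) ^ (1 : ℝ)
      ∂(fstar.law π) ≤ ENNReal.ofReal (Real.exp (-(0 : D → ℝ) π)) := by
    intro π
    simpa using (lintegral_ratio_rpow_le fstar g π one_pos).trans
      (lintegral_affinity_le_one fstar g π one_pos le_rfl)
  obtain ⟨B, hB, hP, hH⟩ := exists_event_ratio_lt fstar a.toPolicy rfl g zero_le_one hx n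
    a.initList.length (a.identList g) (hend g) (-Real.log n)
  refine ⟨B, hB, hP.trans ?_, fun H hHB hpath hest => ?_⟩
  · simp [Real.exp_neg, Real.exp_log hn']
  · subst hest
    have h1 := hH H hHB (a.path_ident hpath (hend _))
    rwa [neg_neg, Real.exp_log hn', ENNReal.rpow_one, ENNReal.ofReal_natCast] at h1

/-- With high probability an estimate with the true laws is accepted. -/
theorem TestToCommit.exists_event_accepts {fstar : Instance D ν}
    (a : TestToCommit R Rmax F n η) (hn : 1 ≤ n) (hN : 1 ≤ programBound n)
    (hend : ∀ f, a.testEnd f ≤ n)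
    (hfeas : ∀ f ∈ F, ∃ w, IsFeasible R F f (programBound n) w) {lam : ℝ} (hlam : 0 < lam)
    (hrate : ∀ f ∈ F, ∀ g ∈ F, ∀ π,
      ∫⁻ o, (g.density π o / f.density π o) ^ lam ∂(f.law π) ≤ ENNReal.ofReal (Real.exp
        (-(lam * truncKL f g (1 / (4 * Fintype.card D * programBound n ^ 2))
          (2 * programBound n) π)))) :
    ∃ B : Set (History D O n), MeasurableSet B ∧
      (historyLaw fstar a.toPolicy n).real B ≤
        (F ×ˢ F).card * Real.exp (-(lam * Real.log n * (1 / (2 * programBound n)))) ∧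
      ∀ H : ℕ → D × O, (fun i : Fin n => H i) ∉ B → IsTypicalPath F fstar a.toPolicy n H →
        fstar.law = (a.estimate H : Instance D ν).law →
        ∀ t, a.testEnd (a.estimate H) ≤ t →
          Accepts R F n (a.estimate H) (fun i : Fin t => H i) a.initList.length
            (a.testEnd (a.estimate H)) := by
  have hn' : (0 : ℝ) < n := by exact_mod_cast hn
  have hlog : 0 ≤ Real.log n := Real.log_nonneg (by exact_mod_cast hn)
  set N := programBound n with hNdef
  have hN0 : 0 < N := by linarith
  have hE := exists_event_forall (μ := historyLaw fstar a.toPolicy n)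
    (F ×ˢ F) (b := Real.exp (-(lam * Real.log n * (1 / (2 * N)))))
    (Q := fun p H => IsTypicalPath F fstar a.toPolicy n H → fstar.law = p.1.law →
      optDecision R p.2 ≠ optDecision R p.1 → (a.estimate H : Instance D ν) = p.1 →
      n ≤ ∏ i ∈ Finset.Ico a.initList.length (a.testEnd (a.estimate H)),
        (p.1.density (H i).1 (H i).2 / p.2.density (H i).1 (H i).2)) ?_
  · obtain ⟨B, hB, hP, hH⟩ := hE
    refine ⟨B, hB, hP, fun H hHB hpath hlaw t ht g hg hopt => ?_⟩
    rw [log_le_logLikelihoodRatio_iff ht hn]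
    exact hH H hHB (a.estimate H, g) (Finset.mk_mem_product (a.estimate H).2 hg) hpath hlaw hopt rfl
  rintro ⟨f, g⟩ hfg
  obtain ⟨hf, hg⟩ := Finset.mem_product.1 hfg
  simp only at hf hg ⊢
  by_cases hlaw : fstar.law = f.law
  swap
  · exact ⟨∅, MeasurableSet.empty, by simp [(Real.exp_pos _).le],
      fun H _ _ h => absurd h hlaw⟩
  by_cases hopt : optDecision R g = optDecision R f
  · exact ⟨∅, MeasurableSet.empty, by simp [(Real.exp_pos _).le],
      fun H _ _ _ h => absurd hopt h⟩
  -- The choice `q = lam * ln n` makes the conclusion a ratio `g / f` below `1/n`; the information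
  -- `(1 + 1/(2N)) ln n` then leaves the exponent `-lam ln n / (2N)`.
  obtain ⟨B, hB, hP, hH⟩ := exists_event_ratio_lt fstar a.toPolicy hlaw g hlam.le
    (hrate f hf g hg) n a.initList.length (a.identList ⟨f, hf⟩) (hend ⟨f, hf⟩)
    (lam * Real.log n)
  refine ⟨B, hB, hP.trans (Real.exp_le_exp.2 ?_), fun H hHB hpath _ _ hest => ?_⟩
  · have h1 := one_add_le_sum_mul_truncKL hN (a.isSolution_weight ⟨f, hf⟩ (hfeas f hf)).1 hg hopt
      (ε := 1 / (4 * Fintype.card D * N ^ 2)) rfl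
    have h2 : lam * Real.log n * (1 + 1 / (2 * N)) ≤
        ∑ π, (((a.identList ⟨f, hf⟩).count π : ℕ) : ℝ) *
          (lam * truncKL f g (1 / (4 * Fintype.card D * N ^ 2)) (2 * N) π) := by
      refine (mul_le_mul_of_nonneg_left h1 (mul_nonneg hlam.le hlog)).trans ?_
      rw [Finset.mul_sum]
      refine Finset.sum_le_sum fun π _ => ?_
      have h3 : ((1 + 1 / N) * a.weight ⟨f, hf⟩ π + 1 / N) * Real.log n ≤
          ((a.identList ⟨f, hf⟩).count π : ℕ) := by
        rw [a.count_identList]; exact Nat.le_ceil _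
      have h4 := mul_le_mul_of_nonneg_right h3 (mul_nonneg hlam.le
        (truncKL_nonneg f g (1 / (4 * Fintype.card D * N ^ 2)) (α := 2 * N) (by positivity) π))
      refine le_trans (le_of_eq ?_) h4
      ring
    linarith
  have hest' : a.estimate H = ⟨f, hf⟩ := Subtype.ext hest
  have h1 := hH H hHB (by rw [← hest']; exact a.path_ident hpath (hend _))
  rw [hest']
  -- Needed to invert the ratio without meeting `0 / 0`. The estimate may differ from `fstar` on a
  -- null set, which typical paths avoid.
  have hfpos : ∀ i ∈ Finset.Ico a.initList.length (a.testEnd ⟨f, hf⟩),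
      f.density (H i).1 (H i).2 ≠ 0 := by
    intro i hi
    have hi' := (Finset.mem_Ico.1 hi).2.trans_le (hend ⟨f, hf⟩)
    rw [hpath.density_eq f hf hlaw i hi']
    exact hpath.density_ne_zero i hi'
  have h2 : ENNReal.ofReal (Real.exp (-(lam * Real.log n))) = ((n : ℝ≥0∞)⁻¹) ^ lam := by
    rw [← ENNReal.ofReal_natCast, ← ENNReal.ofReal_inv_of_pos hn',
      ENNReal.ofReal_rpow_of_pos (inv_pos.2 hn'), Real.rpow_def_of_pos (inv_pos.2 hn'),
      Real.log_inv]
    congr 2; ring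
  rw [h2, ENNReal.rpow_lt_rpow_iff hlam] at h1
  have h3 : ∏ i ∈ Finset.Ico a.initList.length (a.testEnd ⟨f, hf⟩),
      (g.density (H i).1 (H i).2 / f.density (H i).1 (H i).2) =
      (∏ i ∈ Finset.Ico a.initList.length (a.testEnd ⟨f, hf⟩),
        (f.density (H i).1 (H i).2 / g.density (H i).1 (H i).2))⁻¹ := by
    rw [ENNReal.prod_inv_distrib]
    · refine Finset.prod_congr rfl fun i hi => ?_
      rw [ENNReal.inv_div (Or.inl (g.density_ne_top _ _)) (Or.inr (hfpos i hi))]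
    · intro i hi _ _ _
      exact Or.inl (ENNReal.div_ne_zero.2 ⟨hfpos i hi, g.density_ne_top _ _⟩)
  rw [← TestToCommit.testEnd, h3, ENNReal.inv_lt_inv] at h1
  exact h1.le

end Events

/-! ### Counting plays, and the analysis of UCB -/

section Plays

variable {D O : Type*} [DecidableEq D]

/-- The rounds `s ≤ i < t` in which `π` is played. -/
def plays (H : ℕ → D × O) (s t : ℕ) (π : D) : Finset ℕ :=
  (Finset.Ico s t).filter fun i => (H i).1 = π

theorem sum_fin_filter_eq_sum_plays {M : Type*} [AddCommMonoid M] (x : ℕ → M) (H : ℕ → D × O)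
    (s t : ℕ) (π : D) :
    ∑ i ∈ Finset.univ.filter (fun i : Fin t => s ≤ (i : ℕ) ∧ (H i).1 = π), x i =
      ∑ i ∈ plays H s t π, x i := by
  rw [Finset.sum_filter,
    Fin.sum_univ_eq_sum_range (fun i => if s ≤ i ∧ (H i).1 = π then x i else 0) t,
    ← Finset.sum_filter]
  congr 1
  ext i
  simp only [plays, Finset.mem_filter, Finset.mem_range, Finset.mem_Ico]
  tauto

theorem playCount_eq (H : ℕ → D × O) (s t : ℕ) (π : D) :
    playCount (fun i : Fin t => H i) s π = (plays H s t π).card := by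
  rw [playCount, Finset.card_eq_sum_ones, Finset.card_eq_sum_ones]
  exact sum_fin_filter_eq_sum_plays (fun _ => 1) H s t π

theorem empiricalMean_eq (R : O → ℝ) (H : ℕ → D × O) (s t : ℕ) (π : D) :
    empiricalMean R (fun i : Fin t => H i) s π =
      (∑ i ∈ plays H s t π, R (H i).2) / (plays H s t π).card := by
  rw [empiricalMean, playCount_eq]
  congr 1
  exact sum_fin_filter_eq_sum_plays (fun i => R (H i).2) H s t π

theorem card_plays_succ (H : ℕ → D × O) {s t : ℕ} (h : s ≤ t) (π : D) :
    (plays H s (t + 1) π).card = (plays H s t π).card + if (H t).1 = π then 1 else 0 := by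
  simp only [plays, Finset.card_filter]
  rw [Finset.sum_Ico_succ_top h]

theorem sum_Ico_eq_sum_card_plays [Fintype D] (H : ℕ → D × O) (s t : ℕ) (x : D → ℝ) :
    ∑ i ∈ Finset.Ico s t, x (H i).1 = ∑ π, ((plays H s t π).card : ℝ) * x π := by
  rw [← Finset.sum_fiberwise (Finset.Ico s t) (fun i => (H i).1)]
  refine Finset.sum_congr rfl fun π _ => ?_
  rw [← nsmul_eq_mul]
  exact Finset.sum_eq_card_nsmul fun i hi => by rw [(Finset.mem_filter.1 hi).2]

end Plays

section UCB

variable {D O : Type*} [MeasurableSpace O] {ν : Measure O}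

/-- The width of the confidence interval after `k` plays. -/
noncomputable def radius (Rmax : ℝ) (n k : ℕ) : ℝ :=
  Rmax * Real.sqrt (2 * Real.log ((n : ℝ) ^ 2) / k)

theorem radius_sq (Rmax : ℝ) {n k : ℕ} (hn : 1 ≤ n) :
    radius Rmax n k ^ 2 = 4 * Rmax ^ 2 * Real.log n / k := by
  have hlog : 0 ≤ Real.log n := Real.log_nonneg (by exact_mod_cast hn)
  rw [radius, mul_pow, Real.log_pow, Real.sq_sqrt (by push_cast; positivity)]
  push_cast; ring

/-- Hoeffding's lemma: a variable with range of length `Rmax` is sub-Gaussian with variance proxy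
`Rmax² / 4`. -/
theorem lintegral_exp_reward_le_one {R : O → ℝ} (hR : Measurable R) {Rmax : ℝ}
    {f : Instance D ν} {π : D} (hbdd : ∀ᵐ o ∂(f.law π), 0 ≤ R o ∧ R o ≤ Rmax) (θ : ℝ) :
    ∫⁻ o, ENNReal.ofReal (Real.exp (θ * (R o - meanReward R f π) - θ ^ 2 * Rmax ^ 2 / 8))
      ∂(f.law π) ≤ 1 := by
  have hsub := hasSubgaussianMGF_of_mem_Icc (μ := f.law π) (X := R) (a := 0) (b := Rmax)
    hR.aemeasurable hbdd
  have hintegrable := hsub.integrable_exp_mul θ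
  have hle := hsub.mgf_le θ
  have h1 : ∀ o, Real.exp (θ * (R o - meanReward R f π) - θ ^ 2 * Rmax ^ 2 / 8) =
      Real.exp (θ * (R o - ∫ x, R x ∂(f.law π))) * Real.exp (-(θ ^ 2 * Rmax ^ 2 / 8)) := by
    intro o; rw [← Real.exp_add]; rfl
  simp only [h1]
  rw [← ofReal_integral_eq_lintegral_ofReal (hintegrable.mul_const _)
    (ae_of_all _ fun o => by positivity), integral_mul_const]
  rw [mgf] at hle
  refine (ENNReal.ofReal_le_ofReal (mul_le_mul_of_nonneg_right hle (Real.exp_pos _).le)).trans ?_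
  rw [← Real.exp_add, ENNReal.ofReal_le_one, Real.exp_le_one_iff]
  push_cast
  rw [sub_zero, Real.norm_eq_abs, div_pow, sq_abs]
  linarith

variable [Fintype D] [DecidableEq D] [MeasurableSpace D] [DiscreteMeasurableSpace D]

/-- With high probability all empirical means are within the confidence radius of the means. -/
theorem exists_event_confidence {R : O → ℝ} (hR : Measurable R) {Rmax : ℝ} (hRmax : 0 < Rmax)
    {f : Instance D ν} (hbdd : ∀ π, ∀ᵐ o ∂(f.law π), 0 ≤ R o ∧ R o ≤ Rmax) (A : Policy D O)
    {n : ℕ} (hn : 1 ≤ n) :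
    ∃ B : Set (History D O n), MeasurableSet B ∧
      (historyLaw f A n).real B ≤
        2 * Fintype.card D * (n + 1) ^ 3 * Real.exp (-(8 * Real.log n)) ∧
      ∀ H : ℕ → D × O, (fun i : Fin n => H i) ∉ B → ∀ s ≤ n, ∀ t ≤ n, ∀ π,
        (plays H s t π).card ≠ 0 →
          |empiricalMean R (fun i : Fin t => H i) s π - meanReward R f π| <
            radius Rmax n (plays H s t π).card := by
  -- The number of plays is random, so the union runs over its value `k` as well as over the sign,
  -- the decision and the two end points of the window.
  have hE := exists_event_forall (μ := historyLaw f A n)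
    (({1, -1} : Finset ℝ) ×ˢ (Finset.univ : Finset D) ×ˢ Finset.range (n + 1) ×ˢ
      Finset.range (n + 1) ×ˢ Finset.range (n + 1)) (b := Real.exp (-(8 * Real.log n)))
    (Q := fun ⟨σ, π, s, t, k⟩ H => (plays H s t π).card = k → k ≠ 0 →
      σ * (empiricalMean R (fun i : Fin t => H i) s π - meanReward R f π) < radius Rmax n k) ?_
  · obtain ⟨B, hB, hP, hH⟩ := hE
    refine ⟨B, hB, hP.trans (le_of_eq ?_), fun H hHB s hs t ht π hk => ?_⟩
    · have : ({1, -1} : Finset ℝ).card = 2 := Finset.card_pair (by norm_num)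
      simp only [Finset.card_product, this, Finset.card_univ, Finset.card_range]
      push_cast; ring
    · have hk' : (plays H s t π).card ≤ n := by
        refine (Finset.card_filter_le _ _).trans ?_
        rw [Nat.card_Ico]; omega
      have hmem : ∀ σ ∈ ({1, -1} : Finset ℝ), (σ, π, s, t, (plays H s t π).card) ∈
          (({1, -1} : Finset ℝ) ×ˢ (Finset.univ : Finset D) ×ˢ Finset.range (n + 1) ×ˢ
            Finset.range (n + 1) ×ˢ Finset.range (n + 1)) := by
        intro σ hσ
        simp only [Finset.mem_product, Finset.mem_univ, Finset.mem_range]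
        exact ⟨hσ, trivial, by omega, by omega, by omega⟩
      have h1 := hH H hHB _ (hmem 1 (by simp)) rfl hk
      have h2 := hH H hHB _ (hmem (-1) (by simp)) rfl hk
      rw [abs_lt]
      constructor <;> linarith
  rintro ⟨σ, π, s, t, k⟩ hmem
  simp only [Finset.mem_product, Finset.mem_univ, Finset.mem_range, Finset.mem_insert,
    Finset.mem_singleton] at hmem
  obtain ⟨hσ, -, hs, ht, hk⟩ := hmem
  have hσ2 : σ ^ 2 = 1 := by rcases hσ with rfl | rfl <;> norm_num
  set ρ := radius Rmax n k with hρ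
  -- The optimal Chernoff parameter. A deviation of `ρ` contributes `16 ln n` and the variance term
  -- costs `8 ln n`, leaving the exponent `8 ln n`.
  set θ : ℝ := σ * (4 * ρ / Rmax ^ 2) with hθ
  obtain ⟨B, hB, hP, hH⟩ := exists_event_prod_lt f A
    (φ := fun i d o => if (s ≤ i ∧ i < t) ∧ d = π then
      ENNReal.ofReal (Real.exp (θ * (R o - meanReward R f π) - θ ^ 2 * Rmax ^ 2 / 8)) else 1)
    (fun i d => by
      split_ifs
      · fun_prop
      · exact measurable_const)
    (fun i d => by
      split_ifs with h
      · rw [h.2]; exact lintegral_exp_reward_le_one hR (hbdd π) θ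
      · simp) n (8 * Real.log n)
  refine ⟨B, hB, hP, fun H hHB hcard hk0 => ?_⟩
  have h1 := hH H hHB
  have hk1 : (0 : ℝ) < k := by exact_mod_cast Nat.pos_of_ne_zero hk0
  have h2 : (Finset.range n).filter (fun i => (s ≤ i ∧ i < t) ∧ (H i).1 = π) = plays H s t π := by
    ext i
    simp only [plays, Finset.mem_filter, Finset.mem_range, Finset.mem_Ico]
    constructor
    · exact fun h => h.2
    · exact fun h => ⟨by omega, h⟩
  rw [← Finset.prod_filter, h2, ← ENNReal.ofReal_prod_of_nonneg fun i _ => (Real.exp_pos _).le,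
    ← Real.exp_sum, ENNReal.ofReal_lt_ofReal_iff (Real.exp_pos _), Real.exp_lt_exp,
    Finset.sum_sub_distrib, ← Finset.mul_sum, Finset.sum_sub_distrib, Finset.sum_const,
    Finset.sum_const, hcard, nsmul_eq_mul, nsmul_eq_mul] at h1
  rw [empiricalMean_eq, hcard]
  set S := ∑ i ∈ plays H s t π, R (H i).2
  by_contra! hc
  have hρ2 : ρ ^ 2 * k = 4 * Rmax ^ 2 * Real.log n := by
    rw [hρ, radius_sq Rmax hn]; field_simp
  have hρ0 : 0 ≤ ρ := by rw [hρ, radius]; positivity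
  have h3 : θ * (S - k * meanReward R f π) =
      (4 * ρ / Rmax ^ 2 * k) * (σ * (S / k - meanReward R f π)) := by
    rw [hθ]; field_simp
  have h4 : (4 * ρ / Rmax ^ 2 * k) * ρ ≤
      (4 * ρ / Rmax ^ 2 * k) * (σ * (S / k - meanReward R f π)) := by gcongr
  have h5 : (4 * ρ / Rmax ^ 2 * k) * ρ = 16 * Real.log n := by
    calc (4 * ρ / Rmax ^ 2 * k) * ρ = 4 / Rmax ^ 2 * (ρ ^ 2 * k) := by ring
      _ = _ := by rw [hρ2]; field_simp; ring
  have h6 : (k : ℝ) * (θ ^ 2 * Rmax ^ 2 / 8) = 8 * Real.log n := by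
    calc (k : ℝ) * (θ ^ 2 * Rmax ^ 2 / 8) = 2 / Rmax ^ 2 * (ρ ^ 2 * k) := by
          rw [hθ, mul_pow, hσ2]; field_simp; ring
      _ = _ := by rw [hρ2]; field_simp; ring
  linarith

end UCB

section UCBPhase

variable {D O : Type*} [MeasurableSpace O] {ν : Measure O} [Fintype D] [DecidableEq D] [Nonempty D]

/-- A suboptimal decision is played by UCB at most logarithmically often if all empirical means are
within the confidence radius of the means. -/
theorem card_plays_le {R : O → ℝ} {Rmax : ℝ} {f : Instance D ν} {n : ℕ} (hn : 1 ≤ n)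
    {H : ℕ → D × O} {s : ℕ}
    (hconf : ∀ t ≤ n, ∀ π, (plays H s t π).card ≠ 0 →
      |empiricalMean R (fun i : Fin t => H i) s π - meanReward R f π| <
        radius Rmax n (plays H s t π).card)
    (hucb : ∀ t, s ≤ t → t < n → ∀ π, ucbIndex R Rmax n (fun i : Fin t => H i) s π ≤
      ucbIndex R Rmax n (fun i : Fin t => H i) s (H t).1)
    {π : D} (hgap : 0 < gap R f π) {t : ℕ} (hst : s ≤ t) (htn : t ≤ n) :
    ((plays H s t π).card : ℝ) ≤ 16 * Rmax ^ 2 * Real.log n / gap R f π ^ 2 + 1 := by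
  have hlog : 0 ≤ Real.log n := Real.log_nonneg (by exact_mod_cast hn)
  have hX : 0 ≤ 16 * Rmax ^ 2 * Real.log n / gap R f π ^ 2 := by positivity
  induction t, hst using Nat.le_induction with
  | base => simp [plays]; linarith
  | succ t hst ih =>
    rw [card_plays_succ H hst]
    split_ifs with hπ
    swap
    · simpa using ih (by omega)
    push_cast
    gcongr
    -- The play in round `t` is the `+ 1`; it remains to bound the number of plays before it.
    rcases Nat.eq_zero_or_pos (plays H s t π).card with h0 | hpos
    · rw [h0]; simpa using hX
    have hk : (0 : ℝ) < (plays H s t π).card := by exact_mod_cast hpos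
    have h1 := hucb t hst (by omega) (optDecision R f)
    rw [hπ] at h1
    unfold ucbIndex at h1
    rw [playCount_eq, playCount_eq, if_neg hpos.ne'] at h1
    -- An optimal decision not yet played would have index `⊤`, above the real index of `π`.
    -- Otherwise comparing the indices gives a gap of at most two radii.
    split_ifs at h1 with h2
    · exact absurd (top_le_iff.1 h1) (EReal.coe_ne_top _)
    rw [EReal.coe_le_coe_iff] at h1
    have h3 := (abs_lt.1 (hconf t (by omega) _ h2)).1
    have h4 := (abs_lt.1 (hconf t (by omega) π hpos.ne')).2
    change _ + radius Rmax n _ ≤ _ + radius Rmax n _ at h1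
    set ρ := radius Rmax n (plays H s t π).card with hρ
    have h5 : gap R f π ≤ 2 * ρ := by rw [gap]; linarith
    have h6 : gap R f π ^ 2 ≤ (2 * ρ) ^ 2 := by gcongr
    rw [mul_pow, hρ, radius_sq Rmax hn, ← mul_div_assoc, le_div_iff₀ hk] at h6
    rw [le_div_iff₀ (by positivity)]
    linarith

theorem sum_gap_le_of_ucb {R : O → ℝ} {Rmax : ℝ} {f : Instance D ν}
    (hle : ∀ π, gap R f π ≤ Rmax) {n : ℕ} (hn : 1 ≤ n)
    {H : ℕ → D × O} {s : ℕ} (hs : s ≤ n)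
    (hconf : ∀ t ≤ n, ∀ π, (plays H s t π).card ≠ 0 →
      |empiricalMean R (fun i : Fin t => H i) s π - meanReward R f π| <
        radius Rmax n (plays H s t π).card)
    (hucb : ∀ t, s ≤ t → t < n → ∀ π, ucbIndex R Rmax n (fun i : Fin t => H i) s π ≤
      ucbIndex R Rmax n (fun i : Fin t => H i) s (H t).1) :
    ∑ i ∈ Finset.Ico s n, gap R f (H i).1 ≤
      (∑ π, 16 * Rmax ^ 2 / gap R f π) * Real.log n + Fintype.card D * Rmax := by
  rw [sum_Ico_eq_sum_card_plays H s n (gap R f), Finset.sum_mul, ← nsmul_eq_mul,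
    ← Finset.card_univ, ← Finset.sum_const, ← Finset.sum_add_distrib]
  refine Finset.sum_le_sum fun π _ => ?_
  -- For a zero gap the quotient by the gap is `0` by convention, and the term is harmless.
  rcases (gap_nonneg R f π).eq_or_lt with h0 | hpos
  · rw [← h0]; simpa [← h0] using hle π
  · have h1 := mul_le_mul_of_nonneg_right (card_plays_le hn hconf hucb hpos hs le_rfl) hpos.le
    refine h1.trans ?_
    have h2 : (16 * Rmax ^ 2 * Real.log n / gap R f π ^ 2 + 1) * gap R f π =
        16 * Rmax ^ 2 / gap R f π * Real.log n + gap R f π := by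
      field_simp
    rw [h2]
    linarith [hle π]

end UCBPhase

/-! ### Decomposition of the regret -/

section Length

theorem length_eq_sum_count {D : Type*} [Fintype D] [DecidableEq D] (l : List D) :
    l.length = ∑ π, l.count π := by
  rw [← List.sum_toFinset_count_eq_length l]
  exact Finset.sum_subset (Finset.subset_univ _) fun π _ hπ =>
    List.count_eq_zero.2 (by simpa using hπ)

end Length

/-- The test reads only rounds before `b`, so its outcome never changes during exploitation. -/
theorem accepts_iff {D O : Type*} [MeasurableSpace O] {ν : Measure O} [Finite D] [Nonempty D]
    {R : O → ℝ} {F : Finset (Instance D ν)} {n : ℕ} {H : ℕ → D × O} {f : Instance D ν} {s b t : ℕ} (hb : b ≤ t) :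
    Accepts R F n f (fun i : Fin t => H i) s b ↔ Accepts R F n f (fun i : Fin b => H i) s b := by
  simp only [Accepts, logLikelihoodRatio_eq _ _ H hb, logLikelihoodRatio_eq _ _ H le_rfl]

section IntegralGap

variable {D O : Type*} [MeasurableSpace O] {ν : Measure O} [Fintype D] [Nonempty D]
  [MeasurableSpace D] {R : O → ℝ} {Rmax : ℝ}

theorem regret_eq_integral_gap (f : Instance D ν) (A : Policy D O) (n : ℕ) :
    regret R f A n = ∫ h, ∑ i : Fin n, gap R f (h i).1 ∂(historyLaw f A n) := by
  simp only [regret, iSup_meanReward, gap]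

variable [DiscreteMeasurableSpace D]

theorem measurable_sum_gap (f : Instance D ν) (n : ℕ) :
    Measurable fun h : History D O n => ∑ i : Fin n, gap R f (h i).1 :=
  Finset.measurable_sum _ fun i _ =>
    (measurable_of_countable (gap R f)).comp (measurable_fst.comp (measurable_pi_apply i))

theorem integrable_sum_gap {f : Instance D ν} (hle : ∀ π, gap R f π ≤ Rmax) (A : Policy D O)
    (n : ℕ) : Integrable (fun h : History D O n => ∑ i : Fin n, gap R f (h i).1)
      (historyLaw f A n) :=
  Integrable.of_mem_Icc 0 (∑ _i : Fin n, Rmax) (measurable_sum_gap f n).aemeasurable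
    (ae_of_all _ fun _ => ⟨Finset.sum_nonneg fun _ _ => gap_nonneg R f _,
      Finset.sum_le_sum fun _ _ => hle _⟩)

end IntegralGap

section Regret

variable {D O : Type*} [MeasurableSpace O] {ν : Measure O} [Fintype D] [DecidableEq D]
  [Nonempty D] [MeasurableSpace D]
  {R : O → ℝ} {Rmax : ℝ} {F : Finset (Instance D ν)} {n : ℕ} {η : ℝ≥0}

/-- A bound on the number of rounds of the identification step. -/
noncomputable def identLength (D : Type*) [Fintype D] (n : ℕ) : ℝ :=
  Fintype.card D * (((1 + 1 / programBound n) * programBound n + 1 / programBound n) *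
    Real.log n + 1)

/-- A bound on the regret of UCB. -/
noncomputable def ucbBound (R : O → ℝ) (Rmax : ℝ) (f : Instance D ν) (n : ℕ) : ℝ :=
  (∑ π, 16 * Rmax ^ 2 / gap R f π) * Real.log n + Fintype.card D * Rmax

/-- A bound on the regret of the identification step if the estimate has the true laws. -/
noncomputable def identRegret (R : O → ℝ) (Rmax : ℝ) (F : Finset (Instance D ν))
    (f : Instance D ν) (n : ℕ) (η : ℝ≥0) : ℝ :=
  ((1 + 1 / programBound n) * ((complexityAt R F f (programBound n)).toReal + η) +
    1 / programBound n * (Fintype.card D * Rmax)) * Real.log n + Fintype.card D * Rmax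

theorem TestToCommit.length_initList (a : TestToCommit R Rmax F n η) :
    a.initList.length = Fintype.card D * ⌈Real.log n / Real.log (Real.log n)⌉₊ := by
  rw [length_eq_sum_count]
  simp [a.count_initList]

theorem TestToCommit.count_identList_le (a : TestToCommit R Rmax F n η) (hn : 1 ≤ n)
    (hN : 1 ≤ programBound n) (f : F) (π : D) :
    (((a.identList f).count π : ℕ) : ℝ) ≤
      ((1 + 1 / programBound n) * a.weight f π + 1 / programBound n) * Real.log n + 1 := by
  have hlog : 0 ≤ Real.log n := Real.log_nonneg (by exact_mod_cast hn)
  have hN0 : 0 < programBound n := by linarith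
  rw [a.count_identList]
  exact (Nat.ceil_lt_add_one (by positivity)).le

theorem TestToCommit.length_identList_le (a : TestToCommit R Rmax F n η) (hn : 1 ≤ n)
    (hN : 1 ≤ programBound n)
    (hfeas : ∀ f ∈ F, ∃ w, IsFeasible R F f (programBound n) w) (f : F) :
    ((a.identList f).length : ℝ) ≤ identLength D n := by
  have hlog : 0 ≤ Real.log n := Real.log_nonneg (by exact_mod_cast hn)
  have hN0 : 0 < programBound n := by linarith
  rw [length_eq_sum_count, Nat.cast_sum, identLength, ← nsmul_eq_mul, ← Finset.card_univ,
    ← Finset.sum_const]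
  refine Finset.sum_le_sum fun π _ => (a.count_identList_le hn hN f π).trans ?_
  gcongr
  exact (a.isSolution_weight f (hfeas f f.2)).1.2 π

theorem TestToCommit.sum_gap_ident_le (a : TestToCommit R Rmax F n η) (hn : 1 ≤ n)
    (hN : 1 ≤ programBound n)
    (hfeas : ∀ f ∈ F, ∃ w, IsFeasible R F f (programBound n) w) {fstar : Instance D ν}
    (hle : ∀ π, gap R fstar π ≤ Rmax) {f : F} (hlaw : fstar.law = (f : Instance D ν).law) :
    ∑ π, (((a.identList f).count π : ℕ) : ℝ) * gap R fstar π ≤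
      identRegret R Rmax F fstar n η := by
  have hlog : 0 ≤ Real.log n := Real.log_nonneg (by exact_mod_cast hn)
  have hN0 : 0 < programBound n := by linarith
  set N := programBound n with hNdef
  have hsol := a.isSolution_weight f (hfeas f f.2)
  -- With equal laws, the program solved for the estimate is the one for `fstar`.
  have hcost : cost R fstar (a.weight f) ≤ (complexityAt R F fstar N).toReal + η := by
    refine cost_le_of_isSolution ?_
    unfold IsSolution at hsol ⊢
    rwa [isFeasible_congr R F hlaw, cost_congr R hlaw]
  have hsum : ∑ π, gap R fstar π ≤ Fintype.card D * Rmax := by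
    rw [← nsmul_eq_mul, ← Finset.card_univ]
    exact Finset.sum_le_card_nsmul _ _ _ fun π _ => hle π
  calc ∑ π, (((a.identList f).count π : ℕ) : ℝ) * gap R fstar π
      ≤ ∑ π, (((1 + 1 / N) * a.weight f π + 1 / N) * Real.log n + 1) * gap R fstar π :=
        Finset.sum_le_sum fun π _ => mul_le_mul_of_nonneg_right
          (a.count_identList_le hn hN f π) (gap_nonneg R fstar π)
    _ = ((1 + 1 / N) * cost R fstar (a.weight f) + 1 / N * ∑ π, gap R fstar π) * Real.log n +
          ∑ π, gap R fstar π := by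
        rw [cost, Finset.mul_sum, Finset.mul_sum, ← Finset.sum_add_distrib, Finset.sum_mul,
          ← Finset.sum_add_distrib]
        refine Finset.sum_congr rfl fun π _ => ?_
        ring
    _ ≤ _ := by rw [identRegret]; gcongr

theorem TestToCommit.path_commit (a : TestToCommit R Rmax F n η) {f : Instance D ν}
    {H : ℕ → D × O} (hH : IsTypicalPath F f a.toPolicy n H)
    (hacc : Accepts R F n (a.estimate H) (fun i : Fin (a.testEnd (a.estimate H)) => H i)
      a.initList.length (a.testEnd (a.estimate H)))
    {t : ℕ} (ht : a.testEnd (a.estimate H) ≤ t) (htn : t < n) :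
    (H t).1 = optDecision R (a.estimate H : Instance D ν) := by
  rw [hH.act t htn]
  refine a.act_commit t ((Nat.le_add_right _ _).trans ht) _ (a.estimate H) rfl ht ?_
  exact (accepts_iff ht).2 hacc

theorem TestToCommit.path_ucb (a : TestToCommit R Rmax F n η) {f : Instance D ν}
    {H : ℕ → D × O} (hH : IsTypicalPath F f a.toPolicy n H)
    (hacc : ¬ Accepts R F n (a.estimate H) (fun i : Fin (a.testEnd (a.estimate H)) => H i)
      a.initList.length (a.testEnd (a.estimate H)))
    {t : ℕ} (ht : a.testEnd (a.estimate H) ≤ t) (htn : t < n) (π : D) :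
    ucbIndex R Rmax n (fun i : Fin t => H i) (a.testEnd (a.estimate H)) π ≤
      ucbIndex R Rmax n (fun i : Fin t => H i) (a.testEnd (a.estimate H)) (H t).1 := by
  rw [hH.act t htn]
  refine a.act_ucb t ((Nat.le_add_right _ _).trans ht) _ (a.estimate H) rfl ht ?_ π
  exact fun h => hacc ((accepts_iff ht).1 h)

/-- The `eᵢ` stand for indicators of the failure events: each property holds or its indicator is at
least `1`. Acceptance is free unless the optimal decision is wrong (`e₂`). Rejection needs a wrong
estimate (`e₁`) or a failed test of a correct one (`e₃`), and then costs the UCB bound, or the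
trivial `n * Rmax` if the confidence intervals fail (`e₄`). -/
theorem TestToCommit.sum_gap_exploit_le (a : TestToCommit R Rmax F n η) (hn : 1 ≤ n)
    {fstar : Instance D ν} (hle : ∀ π, gap R fstar π ≤ Rmax) {H : ℕ → D × O}
    (hH : IsTypicalPath F fstar a.toPolicy n H) (hend : a.testEnd (a.estimate H) ≤ n)
    {e₁ e₂ e₃ e₄ : ℝ} (h₁ : 0 ≤ e₁) (h₂ : 0 ≤ e₂) (h₃ : 0 ≤ e₃) (h₄ : 0 ≤ e₄)
    (c₁ : fstar.law = (a.estimate H : Instance D ν).law ∨ 1 ≤ e₁)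
    (c₂ : (optDecision R fstar ≠ optDecision R (a.estimate H : Instance D ν) →
      ∀ t, a.testEnd (a.estimate H) ≤ t → ¬ Accepts R F n (a.estimate H) (fun i : Fin t => H i)
        a.initList.length (a.testEnd (a.estimate H))) ∨ 1 ≤ e₂)
    (c₃ : (fstar.law = (a.estimate H : Instance D ν).law →
      ∀ t, a.testEnd (a.estimate H) ≤ t → Accepts R F n (a.estimate H) (fun i : Fin t => H i)
        a.initList.length (a.testEnd (a.estimate H))) ∨ 1 ≤ e₃)
    (c₄ : (∀ s ≤ n, ∀ t ≤ n, ∀ π, (plays H s t π).card ≠ 0 →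
      |empiricalMean R (fun i : Fin t => H i) s π - meanReward R fstar π| <
        radius Rmax n (plays H s t π).card) ∨ 1 ≤ e₄) :
    ∑ i ∈ Finset.Ico (a.testEnd (a.estimate H)) n, gap R fstar (H i).1 ≤
      (e₁ + e₃) * ucbBound R Rmax fstar n + (e₂ + e₄) * (n * Rmax) := by
  have hlog : 0 ≤ Real.log n := Real.log_nonneg (by exact_mod_cast hn)
  have hR0 : 0 ≤ Rmax := (gap_nonneg R fstar (Classical.arbitrary D)).trans (hle _)
  set b := a.testEnd (a.estimate H) with hb
  have hU : 0 ≤ ucbBound R Rmax fstar n := by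
    have : 0 ≤ ∑ π, 16 * Rmax ^ 2 / gap R fstar π :=
      Finset.sum_nonneg fun π _ => div_nonneg (by positivity) (gap_nonneg R fstar π)
    rw [ucbBound]; positivity
  have hnR : 0 ≤ (n : ℝ) * Rmax := by positivity
  have hcrude : ∑ i ∈ Finset.Ico b n, gap R fstar (H i).1 ≤ n * Rmax := by
    refine (Finset.sum_le_card_nsmul _ _ Rmax fun i _ => hle _).trans ?_
    rw [Nat.card_Ico, nsmul_eq_mul]
    gcongr
    omega
  have hA : 0 ≤ (e₁ + e₃) * ucbBound R Rmax fstar n := by positivity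
  have hB : 0 ≤ (e₂ + e₄) * (n * Rmax) := by positivity
  have hbad : 1 ≤ e₂ + e₄ → n * Rmax ≤ (e₂ + e₄) * (n * Rmax) := fun h =>
    le_mul_of_one_le_left hnR h
  by_cases hacc : Accepts R F n (a.estimate H) (fun i : Fin b => H i) a.initList.length b
  · by_cases hopt : optDecision R fstar = optDecision R (a.estimate H : Instance D ν)
    · have h0 : ∑ i ∈ Finset.Ico b n, gap R fstar (H i).1 = 0 := by
        refine Finset.sum_eq_zero fun i hi => ?_
        rw [Finset.mem_Ico] at hi
        rw [a.path_commit hH hacc hi.1 hi.2, ← hopt, gap_optDecision]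
      linarith
    · have h1 : 1 ≤ e₂ := c₂.resolve_left fun h => h hopt b le_rfl hacc
      linarith [hbad (by linarith)]
  · rcases c₄ with c₄ | c₄
    · have h1 : ∑ i ∈ Finset.Ico b n, gap R fstar (H i).1 ≤ ucbBound R Rmax fstar n :=
        sum_gap_le_of_ucb hle hn hend (c₄ b hend)
          fun t ht htn π => a.path_ucb hH hacc ht htn π
      have h2 : 1 ≤ e₁ + e₃ := by
        rcases c₁ with c₁ | c₁
        · linarith [c₃.resolve_left fun h => hacc (h c₁ b le_rfl)]
        · linarith
      linarith [le_mul_of_one_le_left hU h2]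
    · linarith [hbad (by linarith)]

theorem TestToCommit.sum_gap_le (a : TestToCommit R Rmax F n η) (hn : 1 ≤ n)
    (hN : 1 ≤ programBound n) (hfeas : ∀ f ∈ F, ∃ w, IsFeasible R F f (programBound n) w)
    {fstar : Instance D ν} (hle : ∀ π, gap R fstar π ≤ Rmax) {H : ℕ → D × O}
    (hH : IsTypicalPath F fstar a.toPolicy n H) (hend : a.testEnd (a.estimate H) ≤ n)
    {e₁ e₂ e₃ e₄ : ℝ} (h₁ : 0 ≤ e₁) (h₂ : 0 ≤ e₂) (h₃ : 0 ≤ e₃) (h₄ : 0 ≤ e₄)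
    (c₁ : fstar.law = (a.estimate H : Instance D ν).law ∨ 1 ≤ e₁)
    (c₂ : (optDecision R fstar ≠ optDecision R (a.estimate H : Instance D ν) →
      ∀ t, a.testEnd (a.estimate H) ≤ t → ¬ Accepts R F n (a.estimate H) (fun i : Fin t => H i)
        a.initList.length (a.testEnd (a.estimate H))) ∨ 1 ≤ e₂)
    (c₃ : (fstar.law = (a.estimate H : Instance D ν).law →
      ∀ t, a.testEnd (a.estimate H) ≤ t → Accepts R F n (a.estimate H) (fun i : Fin t => H i)
        a.initList.length (a.testEnd (a.estimate H))) ∨ 1 ≤ e₃)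
    (c₄ : (∀ s ≤ n, ∀ t ≤ n, ∀ π, (plays H s t π).card ≠ 0 →
      |empiricalMean R (fun i : Fin t => H i) s π - meanReward R fstar π| <
        radius Rmax n (plays H s t π).card) ∨ 1 ≤ e₄) :
    ∑ i ∈ Finset.range n, gap R fstar (H i).1 ≤
      (a.initList.length * Rmax + identRegret R Rmax F fstar n η) +
        (e₁ * (identLength D n * Rmax + ucbBound R Rmax fstar n) + e₂ * (n * Rmax) +
          e₃ * ucbBound R Rmax fstar n + e₄ * (n * Rmax)) := by
  have hlog : 0 ≤ Real.log n := Real.log_nonneg (by exact_mod_cast hn)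
  have hN0 : 0 < programBound n := by linarith
  have hR0 : 0 ≤ Rmax := (gap_nonneg R fstar (Classical.arbitrary D)).trans (hle _)
  have hexploit := a.sum_gap_exploit_le hn hle hH hend h₁ h₂ h₃ h₄ c₁ c₂ c₃ c₄
  have hinit : ∑ i ∈ Finset.Ico 0 a.initList.length, gap R fstar (H i).1 ≤
      a.initList.length * Rmax := by
    refine (Finset.sum_le_card_nsmul _ _ Rmax fun i _ => hle _).trans ?_
    rw [Nat.card_Ico, nsmul_eq_mul, Nat.sub_zero]
  have hIL : 0 ≤ identLength D n := by rw [identLength]; positivity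
  have hIR : 0 ≤ identRegret R Rmax F fstar n η := by
    have : 0 ≤ (complexityAt R F fstar (programBound n)).toReal :=
      EReal.toReal_nonneg (complexityAt_nonneg R F fstar _)
    rw [identRegret]; positivity
  have hident : ∑ i ∈ Finset.Ico a.initList.length (a.testEnd (a.estimate H)),
      gap R fstar (H i).1 ≤ identRegret R Rmax F fstar n η + e₁ * (identLength D n * Rmax) := by
    have h0 : 0 ≤ e₁ * (identLength D n * Rmax) := by positivity
    rcases c₁ with c₁ | c₁
    · have h5 := sum_Ico_eq_sum_count (a.path_ident hH hend) (gap R fstar)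
      rw [TestToCommit.testEnd, h5]
      linarith [a.sum_gap_ident_le hn hN hfeas hle c₁]
    · have h5 : ∑ i ∈ Finset.Ico a.initList.length (a.testEnd (a.estimate H)),
          gap R fstar (H i).1 ≤ identLength D n * Rmax := by
        refine (Finset.sum_le_card_nsmul _ _ Rmax fun i _ => hle _).trans ?_
        rw [Nat.card_Ico, nsmul_eq_mul, TestToCommit.testEnd, Nat.add_sub_cancel_left]
        gcongr
        exact a.length_identList_le hn hN hfeas _
      have h6 : identLength D n * Rmax ≤ e₁ * (identLength D n * Rmax) :=
        le_mul_of_one_le_left (by positivity) c₁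
      linarith
  rw [Finset.range_eq_Ico, ← Finset.sum_Ico_consecutive _ (Nat.zero_le _) hend,
    ← Finset.sum_Ico_consecutive _ (Nat.zero_le a.initList.length)
      (show a.initList.length ≤ a.testEnd (a.estimate H) from Nat.le_add_right _ _)]
  linarith

variable [DiscreteMeasurableSpace D]

/-- The regret of Test-to-Commit in terms of the probabilities of the exceptional events. -/
theorem TestToCommit.regret_le (a : TestToCommit R Rmax F n η) (hn : 1 ≤ n)
    (hN : 1 ≤ programBound n) (hfeas : ∀ f ∈ F, ∃ w, IsFeasible R F f (programBound n) w)
    (hR : Measurable R) (hRmax : 0 < Rmax) {fstar : Instance D ν} (hfstar : fstar ∈ F)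
    (hbdd : ∀ π, ∀ᵐ o ∂(fstar.law π), 0 ≤ R o ∧ R o ≤ Rmax)
    (hend : ∀ f, a.testEnd f ≤ n) {lam : ℝ} (hlam : 0 < lam)
    (hrate : ∀ f ∈ F, ∀ g ∈ F, ∀ π,
      ∫⁻ o, (g.density π o / f.density π o) ^ lam ∂(f.law π) ≤ ENNReal.ofReal (Real.exp
        (-(lam * truncKL f g (1 / (4 * Fintype.card D * programBound n ^ 2))
          (2 * programBound n) π))))
    {p : ℝ} (hest : ∃ B : Set (History D O n), MeasurableSet B ∧
        (historyLaw fstar a.toPolicy n).real B ≤ p ∧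
        ∀ H : ℕ → D × O, (fun i : Fin n => H i) ∉ B → IsTypicalPath F fstar a.toPolicy n H →
          fstar.law = (a.estimate H : Instance D ν).law) :
    regret R fstar a.toPolicy n ≤
      (a.initList.length * Rmax + identRegret R Rmax F fstar n η) +
        (p * (identLength D n * Rmax + ucbBound R Rmax fstar n) +
          F.card * (1 / n) * (n * Rmax) +
          (F ×ˢ F).card * Real.exp (-(lam * Real.log n * (1 / (2 * programBound n)))) *
            ucbBound R Rmax fstar n +
          2 * Fintype.card D * (n + 1) ^ 3 * Real.exp (-(8 * Real.log n)) * (n * Rmax)) := by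
  have hlog : 0 ≤ Real.log n := Real.log_nonneg (by exact_mod_cast hn)
  have hN0 : 0 < programBound n := by linarith
  have hle := gap_le hR hbdd
  obtain ⟨B₁, hB₁, hP₁, hH₁⟩ := hest
  obtain ⟨B₂, hB₂, hP₂, hH₂⟩ := a.exists_event_not_accepts hfstar hn hend
  obtain ⟨B₃, hB₃, hP₃, hH₃⟩ := a.exists_event_accepts (fstar := fstar) hn hN hend hfeas hlam hrate
  obtain ⟨B₄, hB₄, hP₄, hH₄⟩ := exists_event_confidence hR hRmax hbdd a.toPolicy hn
  set μ := historyLaw fstar a.toPolicy n with hμ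
  have hU : 0 ≤ ucbBound R Rmax fstar n := by
    have : 0 ≤ ∑ π, 16 * Rmax ^ 2 / gap R fstar π :=
      Finset.sum_nonneg fun π _ => div_nonneg (by positivity) (gap_nonneg R fstar π)
    rw [ucbBound]; positivity
  have hIL : 0 ≤ identLength D n := by rw [identLength]; positivity
  have hind : ∀ (B : Set (History D O n)) (c : ℝ), MeasurableSet B →
      Integrable (fun h => B.indicator (fun _ => (1 : ℝ)) h * c) μ := fun B c hB =>
    ((integrable_const 1).indicator hB).mul_const c
  have hval : ∀ (B : Set (History D O n)) (c : ℝ), MeasurableSet B →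
      ∫ h, B.indicator (fun _ => (1 : ℝ)) h * c ∂μ = μ.real B * c := by
    intro B c hB
    rw [integral_mul_const, integral_indicator_const _ hB]; simp
  rw [regret_eq_integral_gap]
  set c₀ := a.initList.length * Rmax + identRegret R Rmax F fstar n η
  set c₁ := identLength D n * Rmax + ucbBound R Rmax fstar n
  calc ∫ h, ∑ i : Fin n, gap R fstar (h i).1 ∂μ
      ≤ ∫ h, (c₀ + (B₁.indicator (fun _ => (1 : ℝ)) h * c₁ +
          B₂.indicator (fun _ => (1 : ℝ)) h * (n * Rmax) +
          B₃.indicator (fun _ => (1 : ℝ)) h * ucbBound R Rmax fstar n +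
          B₄.indicator (fun _ => (1 : ℝ)) h * (n * Rmax))) ∂μ := by
        refine integral_mono_ae (integrable_sum_gap hle a.toPolicy n)
          ((integrable_const _).add ((((hind _ _ hB₁).add (hind _ _ hB₂)).add
            (hind _ _ hB₃)).add (hind _ _ hB₄))) ?_
        filter_upwards [ae_isTypicalPath F fstar a.toPolicy n] with h hh
        -- The value of the extension after round `n` is irrelevant; repeating the first round
        -- avoids any choice.
        obtain ⟨H, rfl⟩ : ∃ H : ℕ → D × O, h = fun i : Fin n => H i :=
          ⟨fun i => if hi : i < n then h ⟨i, hi⟩ else h ⟨0, hn⟩, funext fun i => by simp⟩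
        have hpath := hh H rfl
        have hcases : ∀ (B : Set (History D O n)),
            (fun i : Fin n => H i) ∉ B ∨
              1 ≤ B.indicator (fun _ => (1 : ℝ)) (fun i : Fin n => H i) := by
          intro B
          by_cases hB : (fun i : Fin n => H i) ∈ B
          · right; rw [Set.indicator_of_mem hB]
          · exact Or.inl hB
        have hnn : ∀ (B : Set (History D O n)),
            0 ≤ B.indicator (fun _ => (1 : ℝ)) (fun i : Fin n => H i) := fun B =>
          Set.indicator_nonneg (fun _ _ => zero_le_one) _
        change ∑ i : Fin n, gap R fstar (H i).1 ≤ _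
        rw [Fin.sum_univ_eq_sum_range (fun i => gap R fstar (H i).1) n]
        exact a.sum_gap_le hn hN hfeas hle hpath (hend _) (hnn B₁) (hnn B₂) (hnn B₃) (hnn B₄)
          ((hcases B₁).imp_left fun h => hH₁ H h hpath)
          ((hcases B₂).imp_left fun h => hH₂ H h hpath)
          ((hcases B₃).imp_left fun h => hH₃ H h hpath)
          ((hcases B₄).imp_left fun h => hH₄ H h)
    _ = c₀ + (μ.real B₁ * c₁ + μ.real B₂ * (n * Rmax) + μ.real B₃ * ucbBound R Rmax fstar n +
          μ.real B₄ * (n * Rmax)) := by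
        have i₁₂ := (hind B₁ c₁ hB₁).add (hind B₂ (n * Rmax) hB₂)
        have i₁₃ := i₁₂.add (hind B₃ (ucbBound R Rmax fstar n) hB₃)
        rw [integral_add (integrable_const _) (by exact i₁₃.add (hind B₄ (n * Rmax) hB₄)),
          integral_add (by exact i₁₃) (hind _ _ hB₄), integral_add (by exact i₁₂) (hind _ _ hB₃),
          integral_add (hind _ _ hB₁) (hind _ _ hB₂), hval _ _ hB₁, hval _ _ hB₂, hval _ _ hB₃,
          hval _ _ hB₄]
        simp
    _ ≤ _ := by gcongr

end Regret

/-! ### Growth rates -/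

section Asymptotics

theorem tendsto_log_natCast : Tendsto (fun n : ℕ => Real.log n) atTop atTop :=
  Real.tendsto_log_atTop.comp tendsto_natCast_atTop_atTop

theorem tendsto_log_log_natCast : Tendsto (fun n : ℕ => Real.log (Real.log n)) atTop atTop :=
  Real.tendsto_log_atTop.comp tendsto_log_natCast

theorem tendsto_programBound : Tendsto programBound atTop atTop :=
  (tendsto_rpow_atTop (by norm_num)).comp tendsto_log_log_natCast

theorem eventually_mul_pow_log_le (C : ℝ) (k : ℕ) :
    ∀ᶠ x : ℝ in atTop, C * Real.log x ^ k ≤ x := by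
  have h := (Real.isLittleO_pow_log_id_atTop (n := k)).bound (c := 1 / (|C| + 1)) (by positivity)
  filter_upwards [h, eventually_ge_atTop 1] with x hx h1
  have h0 : 0 ≤ Real.log x ^ k := pow_nonneg (Real.log_nonneg h1) k
  rw [Real.norm_of_nonneg h0, id, Real.norm_of_nonneg (by linarith), one_div,
    inv_mul_eq_div, le_div_iff₀ (by positivity)] at hx
  nlinarith [le_abs_self C]

theorem eventually_programBound_le : ∀ᶠ n : ℕ in atTop,
    programBound n ≤ Real.log (Real.log n) := by
  filter_upwards [tendsto_log_log_natCast.eventually_ge_atTop 1] with n hn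
  exact (Real.rpow_le_rpow_of_exponent_le hn (by norm_num)).trans_eq (Real.rpow_one _)

theorem tendsto_ceil_div_log :
    Tendsto (fun n : ℕ => (⌈Real.log n / Real.log (Real.log n)⌉₊ : ℝ) / Real.log n)
      atTop (𝓝 0) := by
  have h1 : Tendsto (fun n : ℕ => (Real.log (Real.log n))⁻¹ + (Real.log n)⁻¹) atTop (𝓝 0) := by
    simpa using (tendsto_inv_atTop_zero.comp tendsto_log_log_natCast).add
      (tendsto_inv_atTop_zero.comp tendsto_log_natCast)
  refine squeeze_zero' ?_ ?_ h1
  · filter_upwards [tendsto_log_natCast.eventually_ge_atTop 1] with n hn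
    positivity
  · filter_upwards [tendsto_log_natCast.eventually_ge_atTop 1,
      tendsto_log_log_natCast.eventually_ge_atTop 1] with n hn hn'
    rw [div_le_iff₀ (by linarith)]
    refine (Nat.ceil_lt_add_one (div_nonneg (by linarith) (by linarith))).le.trans (le_of_eq ?_)
    have : Real.log n ≠ 0 := by linarith
    field_simp

/-- The estimation error of the maximum likelihood method decays faster than the reciprocal of the
bound in the program. -/
theorem tendsto_exp_mul_programBound {c : ℝ} (hc : 0 < c) :
    Tendsto (fun n : ℕ => Real.exp (-(c * ⌈Real.log n / Real.log (Real.log n)⌉₊)) *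
      programBound n) atTop (𝓝 0) := by
  have h1 : Tendsto (fun n : ℕ => Real.log (Real.log n) ^ (1 : ℝ) *
      Real.exp (-c * Real.log (Real.log n))) atTop (𝓝 0) :=
    (tendsto_rpow_mul_exp_neg_mul_atTop_nhds_zero 1 c hc).comp tendsto_log_log_natCast
  refine squeeze_zero' ?_ ?_ h1
  · filter_upwards [tendsto_programBound.eventually_ge_atTop 0] with n hn
    positivity
  · filter_upwards [tendsto_programBound.eventually_ge_atTop 0, eventually_programBound_le,
      tendsto_log_log_natCast.eventually_ge_atTop 1,
      tendsto_log_natCast.eventually (eventually_mul_pow_log_le 1 2)] with n hn hle hy hx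
    rw [Real.rpow_one, mul_comm]
    -- With `y = ln ln n`, eventually `y² ≤ ln n`, so the exponent is at least `c y`. Since also `N
    -- ≤ y`, the product is at most `y exp(-c y)`.
    have h2 : Real.log (Real.log n) ≤ (⌈Real.log n / Real.log (Real.log n)⌉₊ : ℝ) := by
      refine le_trans ?_ (Nat.le_ceil _)
      rw [le_div_iff₀ (by linarith)]
      nlinarith
    gcongr
    nlinarith

/-- The step `λ` at which the Rényi divergence is compared to the KL divergence in round `n`. -/
noncomputable def renyiStep (K c₁ c₃ ι : ℝ) (n : ℕ) : ℝ :=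
  (1 / (4 * K * programBound n ^ 2)) ^ c₁ * (1 / (2 * programBound n)) ^ c₃ * ι

theorem renyiStep_eq {K c₁ c₃ ι : ℝ} (hK : 0 < K) {n : ℕ} (hN : 0 < programBound n) :
    renyiStep K c₁ c₃ ι n =
      (1 / (4 * K)) ^ c₁ * (1 / 2) ^ c₃ * ι * programBound n ^ (-(2 * c₁ + c₃)) := by
  set N := programBound n with hNdef
  have h1 : (1 / (4 * K * N ^ 2)) ^ c₁ = (1 / (4 * K)) ^ c₁ * N ^ (-(2 * c₁)) := by
    rw [show 1 / (4 * K * N ^ 2) = (1 / (4 * K)) * N ^ (-2 : ℝ) by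
      rw [Real.rpow_neg hN.le]; norm_num; ring,
      Real.mul_rpow (by positivity) (by positivity), ← Real.rpow_mul hN.le]
    ring_nf
  have h2 : (1 / (2 * N)) ^ c₃ = (1 / 2) ^ c₃ * N ^ (-c₃) := by
    rw [show 1 / (2 * N) = (1 / 2) * N ^ (-1 : ℝ) by
      rw [Real.rpow_neg hN.le]; norm_num; ring,
      Real.mul_rpow (by positivity) (by positivity), ← Real.rpow_mul hN.le]
    ring_nf
  rw [renyiStep, ← hNdef, h1, h2, neg_add, Real.rpow_add hN]
  ring

theorem tendsto_renyiStep {K c₁ c₃ ι : ℝ} (hK : 0 < K) (h₁ : 0 < c₁) (h₃ : 0 < c₃) :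
    Tendsto (renyiStep K c₁ c₃ ι) atTop (𝓝 0) := by
  have h := ((tendsto_rpow_neg_atTop (show 0 < 2 * c₁ + c₃ by positivity)).comp
    tendsto_programBound).const_mul ((1 / (4 * K)) ^ c₁ * (1 / 2) ^ c₃ * ι)
  rw [mul_zero] at h
  refine h.congr' ?_
  filter_upwards [tendsto_programBound.eventually_gt_atTop 0] with n hn
  exact (renyiStep_eq hK hn).symm

/-- By `renyiStep_eq` the exponent is a constant times `ln n / N ^ q` with `q = 2 c₁ + c₃ + 1`, and
`N ^ q = (ln ln n)^(q/4)` is of lower order than `ln n`. The polynomial lower bound on `λ₀` in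
Condition 1 is what makes this work. -/
theorem tendsto_exp_renyiStep {K c₁ c₃ ι : ℝ} (hK : 0 < K) (hι : 0 < ι) :
    Tendsto (fun n : ℕ => Real.exp (-(renyiStep K c₁ c₃ ι n * Real.log n *
      (1 / (2 * programBound n))))) atTop (𝓝 0) := by
  refine Real.tendsto_exp_atBot.comp (tendsto_neg_atTop_atBot.comp ?_)
  set q : ℝ := 2 * c₁ + c₃ + 1 with hq
  set A : ℝ := (1 / (4 * K)) ^ c₁ * (1 / 2) ^ c₃ * ι * (1 / 2) with hA
  have hA0 : 0 < A := by positivity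
  have h1 : Tendsto (fun x : ℝ => Real.log x ^ (q / 4) / x ^ (1 : ℝ)) atTop (𝓝 0) :=
    (isLittleO_log_rpow_rpow_atTop (q / 4) one_pos).tendsto_div_nhds_zero
  have h2 : Tendsto (fun x : ℝ => Real.log x ^ (q / 4) / x ^ (1 : ℝ)) atTop (𝓝[>] 0) := by
    refine tendsto_nhdsWithin_iff.2 ⟨h1, ?_⟩
    filter_upwards [eventually_gt_atTop 1] with x hx
    have := Real.log_pos hx
    exact Set.mem_Ioi.2 (div_pos (Real.rpow_pos_of_pos this _)
      (Real.rpow_pos_of_pos (by linarith) _))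
  have h3 := (h2.inv_tendsto_nhdsGT_zero.comp tendsto_log_natCast).const_mul_atTop hA0
  refine h3.congr' ?_
  filter_upwards [tendsto_log_log_natCast.eventually_gt_atTop 0,
    tendsto_programBound.eventually_gt_atTop 0] with n hy hN
  have h4 : Real.log (Real.log n) ^ (q / 4) = programBound n ^ q := by
    rw [programBound, ← Real.rpow_mul hy.le]; ring_nf
  simp only [Function.comp, Pi.inv_apply, Real.rpow_one, inv_div, h4]
  rw [renyiStep_eq hK hN, Real.rpow_neg hN.le, hq, Real.rpow_add hN, Real.rpow_one, hA]
  field_simp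

theorem tendsto_exp_ceil {c : ℝ} (hc : 0 < c) :
    Tendsto (fun n : ℕ => Real.exp (-(c * ⌈Real.log n / Real.log (Real.log n)⌉₊)))
      atTop (𝓝 0) := by
  refine squeeze_zero' (Eventually.of_forall fun n => (Real.exp_pos _).le) ?_
    (tendsto_exp_mul_programBound hc)
  filter_upwards [tendsto_programBound.eventually_ge_atTop 1] with n hn
  exact le_mul_of_one_le_right (Real.exp_pos _).le hn

theorem tendsto_inv_programBound : Tendsto (fun n => 1 / programBound n) atTop (𝓝 0) :=
  tendsto_programBound.const_div_atTop 1

theorem tendsto_const_div_log (C : ℝ) : Tendsto (fun n : ℕ => C / Real.log n) atTop (𝓝 0) :=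
  tendsto_log_natCast.const_div_atTop C

theorem tendsto_exp_mul_identLength (D : Type*) [Fintype D] {c : ℝ} (hc : 0 < c) :
    Tendsto (fun n : ℕ => Real.exp (-(c * ⌈Real.log n / Real.log (Real.log n)⌉₊)) *
      (identLength D n / Real.log n)) atTop (𝓝 0) := by
  have h := ((tendsto_exp_mul_programBound hc).add ((tendsto_exp_ceil hc).mul
    ((tendsto_inv_programBound.const_add 1).add (tendsto_const_div_log 1)))).const_mul
      (Fintype.card D : ℝ)
  simp only [zero_mul, add_zero, mul_zero] at h
  refine h.congr' ?_
  filter_upwards [tendsto_log_natCast.eventually_gt_atTop 0,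
    tendsto_programBound.eventually_gt_atTop 0] with n hx hN
  rw [identLength]
  field_simp
  ring

/-- Initialization and identification together take `O((ln n)²)` rounds, hence end before the
horizon. -/
theorem eventually_length_le (D : Type*) [Fintype D] :
    ∀ᶠ n : ℕ in atTop, Fintype.card D * (⌈Real.log n / Real.log (Real.log n)⌉₊ : ℝ) +
      identLength D n ≤ n := by
  filter_upwards [tendsto_log_natCast.eventually_ge_atTop 1,
    tendsto_log_log_natCast.eventually_ge_atTop 1, tendsto_programBound.eventually_ge_atTop 1,
    eventually_programBound_le,
    tendsto_natCast_atTop_atTop.eventually (eventually_mul_pow_log_le (6 * Fintype.card D) 2)]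
    with n hx hy hN hNy hn
  set x := Real.log n
  set N := programBound n with hNdef
  have hNx : N ≤ x := hNy.trans (Real.log_le_self (by linarith))
  have h1 : (⌈x / Real.log x⌉₊ : ℝ) ≤ x + 1 :=
    (Nat.ceil_lt_add_one (div_nonneg (by linarith) (by linarith))).le.trans
      (by gcongr; exact div_le_self (by linarith) hy)
  have h2 : (1 + 1 / N) * N + 1 / N ≤ x + 2 := by
    have h3 : (1 + 1 / N) * N = N + 1 := by field_simp
    have h4 : 1 / N ≤ 1 := by rw [div_le_one (by linarith)]; exact hN
    linarith
  have h5 : identLength D n ≤ Fintype.card D * ((x + 2) * x + 1) := by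
    rw [identLength]; gcongr
  have hK : (0 : ℝ) ≤ Fintype.card D := by positivity
  calc Fintype.card D * (⌈x / Real.log x⌉₊ : ℝ) + identLength D n
      ≤ Fintype.card D * (x + 1) + Fintype.card D * ((x + 2) * x + 1) := by gcongr
    _ = Fintype.card D * (x ^ 2 + 3 * x + 2) := by ring
    _ ≤ Fintype.card D * (6 * x ^ 2) := by gcongr; nlinarith
    _ ≤ n := by linarith

end Asymptotics

/-! ### Limits of the terms of the regret bound -/

section Limit

variable {D O : Type*} [MeasurableSpace O] {ν : Measure O} [Fintype D] [Nonempty D]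

theorem tendsto_ucbBound_div (R : O → ℝ) (Rmax : ℝ) (f : Instance D ν) :
    Tendsto (fun n : ℕ => ucbBound R Rmax f n / Real.log n) atTop
      (𝓝 (∑ π, 16 * Rmax ^ 2 / gap R f π)) := by
  have h := (tendsto_const_div_log (Fintype.card D * Rmax)).const_add
    (∑ π, 16 * Rmax ^ 2 / gap R f π)
  rw [add_zero] at h
  refine h.congr' ?_
  filter_upwards [tendsto_log_natCast.eventually_gt_atTop 0] with n hn
  rw [ucbBound, add_div, mul_div_cancel_right₀ _ hn.ne']

theorem tendsto_identRegret_div (R : O → ℝ) (Rmax : ℝ) {F : Finset (Instance D ν)}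
    {f : Instance D ν} (hf : f ∈ F) {η : ℕ → ℝ≥0} (hη : Tendsto η atTop (𝓝 0)) :
    Tendsto (fun n : ℕ => identRegret R Rmax F f n (η n) / Real.log n) atTop
      (𝓝 (complexity R F f).toReal) := by
  have hbot : complexity R F f ≠ ⊥ := by
    have : 0 ≤ complexity R F f :=
      ge_of_tendsto' (tendsto_complexityAt R F f) (complexityAt_nonneg R F f)
    exact fun h => by simp [h] at this
  have hC : Tendsto (fun n : ℕ => (complexityAt R F f (programBound n)).toReal) atTop
      (𝓝 (complexity R F f).toReal) :=
    (EReal.tendsto_toReal (complexity_ne_top R hf) hbot).comp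
      ((tendsto_complexityAt R F f).comp tendsto_programBound)
  have hη' : Tendsto (fun n => (η n : ℝ)) atTop (𝓝 0) := by
    simpa using (NNReal.tendsto_coe.2 hη)
  have h := (((tendsto_inv_programBound.const_add 1).mul (hC.add hη')).add
    (tendsto_inv_programBound.mul_const (Fintype.card D * Rmax))).add
    (tendsto_const_div_log (Fintype.card D * Rmax))
  simp only [add_zero, one_mul, zero_mul] at h
  refine h.congr' ?_
  filter_upwards [tendsto_log_natCast.eventually_gt_atTop 0] with n hn
  rw [identRegret, add_div, mul_div_cancel_right₀ _ hn.ne']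

/-- The union over `O(n³)` cases and the cost `O(n)` are absorbed by `exp(-8 ln n) = n⁻⁸`; the crude
bound `8 / ln n` suffices. -/
theorem tendsto_confidence_div (K Rmax : ℝ) :
    Tendsto (fun n : ℕ => 2 * K * ((n : ℝ) + 1) ^ 3 * Real.exp (-(8 * Real.log n)) * (n * Rmax) /
      Real.log n) atTop (𝓝 0) := by
  have h1 : Tendsto (fun n : ℕ => ((n : ℝ) + 1) ^ 3 * Real.exp (-(8 * Real.log n)) * n /
      Real.log n) atTop (𝓝 0) := by
    refine squeeze_zero' ?_ ?_ (tendsto_const_div_log 8)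
    · filter_upwards [tendsto_log_natCast.eventually_gt_atTop 0] with n hn
      positivity
    · filter_upwards [tendsto_log_natCast.eventually_gt_atTop 0, eventually_ge_atTop 1]
        with n hx hn
      have hn1 : (1 : ℝ) ≤ n := by exact_mod_cast hn
      have hexp : Real.exp (-(8 * Real.log n)) = ((n : ℝ) ^ 8)⁻¹ := by
        rw [Real.exp_neg, mul_comm, Real.exp_mul, Real.exp_log (by linarith)]
        norm_cast
      rw [hexp]
      gcongr
      rw [mul_right_comm, ← div_eq_mul_inv, div_le_iff₀ (by positivity)]
      calc ((n : ℝ) + 1) ^ 3 * n ≤ (2 * n) ^ 3 * n := by gcongr; linarith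
        _ = 8 * (n : ℝ) ^ 4 := by ring
        _ ≤ 8 * (n : ℝ) ^ 8 := by
          gcongr 8 * ?_
          exact pow_le_pow_right₀ hn1 (by norm_num)
  have h2 := h1.const_mul (2 * K * Rmax)
  rw [mul_zero] at h2
  exact h2.congr fun n => by ring

/-- For the degenerate case `Rmax ≤ 0`, in which the Chernoff parameter of the confidence bound
would divide by zero or have no meaning. -/
theorem regret_nonpos {R : O → ℝ} {f : Instance D ν} (hle : ∀ π, gap R f π ≤ 0)
    [MeasurableSpace D] (A : Policy D O) (n : ℕ) : regret R f A n ≤ 0 := by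
  rw [regret_eq_integral_gap]
  exact integral_nonpos fun h => Finset.sum_nonpos fun i _ => hle _

end Limit

/-! ### Assembling the bound -/

section Main

variable {D O : Type*} [MeasurableSpace O] {ν : Measure O} [Fintype D] [DecidableEq D]
  [Nonempty D] [MeasurableSpace D] [DiscreteMeasurableSpace D]

theorem limsup_regret_le {R : O → ℝ} (hR : Measurable R) {Rmax : ℝ} (hRmax : 0 < Rmax)
    {F : Finset (Instance D ν)} (hF : UniformRenyiConvergence F) {η : ℕ → ℝ≥0}
    (hη : Tendsto η atTop (𝓝 0)) (alg : ∀ n, TestToCommit R Rmax F n (η n))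
    {fstar : Instance D ν} (hfstar : fstar ∈ F)
    (hbdd : ∀ π, ∀ᵐ o ∂(fstar.law π), 0 ≤ R o ∧ R o ≤ Rmax) :
    limsup (fun n : ℕ => ((regret R fstar (alg n).toPolicy n / Real.log n : ℝ) : EReal)) atTop
      ≤ complexity R F fstar := by
  obtain ⟨c, hc, hest⟩ := TestToCommit.exists_event_estimate (R := R) (Rmax := Rmax) hF hfstar
  obtain ⟨c₁, c₂, c₃, ι, h₁, h₂, h₃, hι, hrate⟩ := hF.exists_rate
  have hK : (1 : ℝ) ≤ Fintype.card D := by exact_mod_cast Fintype.card_pos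
  set K : ℝ := (Fintype.card D : ℝ) with hKdef
  set p : ℕ → ℝ := fun n =>
    Real.exp (-(c * ⌈Real.log n / Real.log (Real.log n)⌉₊)) with hp
  set lam := renyiStep K c₁ c₃ ι with hlam
  -- The bound of `TestToCommit.regret_le` divided by `ln n`, regrouped so that every term is a
  -- product of sequences with known limits.
  set Y : ℕ → ℝ := fun n =>
    (K * Rmax * (⌈Real.log n / Real.log (Real.log n)⌉₊ / Real.log n) +
      identRegret R Rmax F fstar n (η n) / Real.log n) +
    (F.card * (Rmax * (p n * (identLength D n / Real.log n)) +
      p n * (ucbBound R Rmax fstar n / Real.log n)) + F.card * Rmax / Real.log n +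
      (F ×ˢ F).card * (Real.exp (-(lam n * Real.log n * (1 / (2 * programBound n)))) *
        (ucbBound R Rmax fstar n / Real.log n)) +
      2 * K * ((n : ℝ) + 1) ^ 3 * Real.exp (-(8 * Real.log n)) * (n * Rmax) / Real.log n) with hY
  have hYlim : Tendsto Y atTop (𝓝 (complexity R F fstar).toReal) := by
    have h := ((tendsto_ceil_div_log.const_mul (K * Rmax)).add
      (tendsto_identRegret_div R Rmax hfstar hη)).add
      ((((((tendsto_exp_mul_identLength D hc).const_mul Rmax).add
        ((tendsto_exp_ceil hc).mul (tendsto_ucbBound_div R Rmax fstar))).const_mul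
          (F.card : ℝ)).add (tendsto_const_div_log (F.card * Rmax))).add
        (((tendsto_exp_renyiStep (c₁ := c₁) (c₃ := c₃) (zero_lt_one.trans_le hK) hι).mul
          (tendsto_ucbBound_div R Rmax fstar)).const_mul ((F ×ˢ F).card : ℝ)) |>.add
        (tendsto_confidence_div K Rmax))
    simpa only [mul_zero, zero_mul, add_zero, zero_add] using h
  have hYle : ∀ᶠ n : ℕ in atTop, regret R fstar (alg n).toPolicy n / Real.log n ≤ Y n := by
    filter_upwards [eventually_ge_atTop 1, tendsto_log_natCast.eventually_gt_atTop 0,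
      tendsto_programBound.eventually_ge_atTop 1,
      tendsto_programBound.eventually_ge_atTop (1 / (2 * c₂)),
      tendsto_programBound.eventually (eventually_exists_isFeasible R F),
      eventually_length_le D,
      (tendsto_renyiStep (ι := ι) (zero_lt_one.trans_le hK) h₁ h₃).eventually
        (gt_mem_nhds zero_lt_one)] with n hn hx hN hN2 hfeas hlen hl1
    have hN0 : 0 < programBound n := by linarith
    have hn0 : (n : ℝ) ≠ 0 := by positivity
    have hend : ∀ f, (alg n).testEnd f ≤ n := by
      intro f
      have h5 := (alg n).length_identList_le hn hN hfeas f
      have h6 : (((alg n).testEnd f : ℕ) : ℝ) ≤ n := by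
        rw [TestToCommit.testEnd, (alg n).length_initList]
        push_cast
        linarith
      exact_mod_cast h6
    have hinit : (alg n).initList.length ≤ n :=
      (Nat.le_add_right _ _).trans (hend ⟨fstar, hfstar⟩)
    have hl0 : 0 < lam n := by rw [hlam, renyiStep]; positivity
    -- For large `n` the cap `α = 2N` makes `1/α` the smaller entry, so `renyiStep` is exactly the
    -- step that Condition 1 allows.
    have hmin : min (1 / (2 * programBound n)) c₂ = 1 / (2 * programBound n) := by
      refine min_eq_left ?_
      rw [div_le_iff₀ (by positivity)] at hN2 ⊢
      linarith
    have hr := fun f hf g hg π => hrate (2 * programBound n)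
      (1 / (4 * K * programBound n ^ 2)) (lam n) (by positivity) (by positivity)
      (by rw [div_lt_one (by positivity)]; nlinarith) hl0 hl1 (by rw [hmin, hlam, renyiStep])
      f hf g hg π
    have hreg := (alg n).regret_le hn hN hfeas hR hRmax hfstar hbdd hend hl0 hr
      (hest n (η n) (alg n) hinit)
    rw [div_le_iff₀ hx]
    refine hreg.trans (le_of_eq ?_)
    rw [(alg n).length_initList, hY, Nat.cast_mul, ← hKdef]
    simp only [hp]
    generalize Real.exp (-(c * _)) = E₁
    generalize Real.exp (-(8 * _)) = E₂
    generalize Real.exp (-(lam n * _ * _)) = E₃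
    generalize ⌈Real.log n / Real.log (Real.log n)⌉₊ = m
    field_simp
  have hlim : Tendsto (fun n => ((Y n : ℝ) : EReal)) atTop (𝓝 (complexity R F fstar)) := by
    have hbot : complexity R F fstar ≠ ⊥ := by
      have : 0 ≤ complexity R F fstar :=
        ge_of_tendsto' (tendsto_complexityAt R F fstar) (complexityAt_nonneg R F fstar)
      exact fun h => by simp [h] at this
    have h := (continuous_coe_real_ereal.tendsto _).comp hYlim
    rwa [EReal.coe_toReal (complexity_ne_top R hfstar) hbot] at h
  rw [← hlim.limsup_eq]
  exact limsup_le_limsup (hYle.mono fun n hn => EReal.coe_le_coe_iff.2 hn)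

end Main

end DecisionMaking

theorem mainTheorem1 {D O : Type*} [Fintype D] [DecidableEq D] [Nonempty D]
    [MeasurableSpace D] [DiscreteMeasurableSpace D] [MeasurableSpace O]
    (ν : Measure O) [SigmaFinite ν]
    (R : O → ℝ) (hR : Measurable R) (Rmax : ℝ)
    (F : Finset (DecisionMaking.Instance D ν))
    (hbdd : ∀ f ∈ F, ∀ π, ∀ᵐ o ∂(f.law π), 0 ≤ R o ∧ R o ≤ Rmax)
    (huniq : ∀ f ∈ F, ∃! π, DecisionMaking.IsOptimal R f π)
    (hcond : DecisionMaking.UniformRenyiConvergence F)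
    (η : ℕ → ℝ≥0) (hη : Tendsto η atTop (𝓝 0))
    (alg : ∀ n, DecisionMaking.TestToCommit R Rmax F n (η n))
    (fstar : DecisionMaking.Instance D ν) (hfstar : fstar ∈ F) :
    Tendsto (fun N : ℝ => DecisionMaking.complexityAt R F fstar N) atTop
        (𝓝 (DecisionMaking.complexity R F fstar)) ∧
      DecisionMaking.complexity R F fstar ≠ ⊤ ∧
      limsup (fun n : ℕ =>
          ((DecisionMaking.regret R fstar (alg n).toPolicy n / Real.log n : ℝ) : EReal)) atTop
        ≤ DecisionMaking.complexity R F fstar := by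
  refine ⟨DecisionMaking.tendsto_complexityAt R F fstar,
    DecisionMaking.complexity_ne_top R hfstar, ?_⟩
  have hle := DecisionMaking.gap_le hR (hbdd fstar hfstar)
  rcases lt_or_ge 0 Rmax with hpos | hneg
  · exact DecisionMaking.limsup_regret_le hR hpos hcond hη alg hfstar (hbdd fstar hfstar)
  · have h0 : 0 ≤ DecisionMaking.complexity R F fstar :=
      ge_of_tendsto' (DecisionMaking.tendsto_complexityAt R F fstar)
        (DecisionMaking.complexityAt_nonneg R F fstar)
    refine le_trans ?_ h0
    refine limsup_le_of_le (by isBoundedDefault) (Eventually.of_forall fun n => ?_)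
    rw [← EReal.coe_zero, EReal.coe_le_coe_iff]
    exact div_nonpos_of_nonpos_of_nonneg
      (DecisionMaking.regret_nonpos (fun π => (hle π).trans hneg) _ n) (Real.log_natCast_nonneg n)
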